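/- Let $n\ge 1$ and let $\mathbb{R}^{2n}=\mathbb{R}^n_q\times\mathbb{R}^n_p$ carry the standard inner product, the standard symplectic form $\omega=\sum_i dq_i\wedge dp_i$ and the complex structure $J(q,p)=(-p,q)$. A convex body is a compact convex set with non-empty interior; $h_\Sigma(u)=\sup\{\langle x,u\rangle : x\in\Sigma\}$ is the support function of $\Sigma$. For a convex body $\Sigma'\subset\mathbb{R}^{2n}$ with smooth ($C^\infty$) boundary, a closed characteristic on $\partial\Sigma'$ is a smoothly embedded circle $\gamma\subset\partial\Sigma'$ that is tangent at each of its points $x$ to the line $\{\xi\in T_x\partial\Sigma' : \omega(\xi,\eta)=0 \text{ for all } \eta\in T_x\partial\Sigma'\}$. Its action, for a regular $2\pi$-periodic parametrization, is $A(\gamma)=\frac12\int_0^{2\pi}\langle J\gamma(t),\dot\gamma(t)\rangle\,dt$, and $$c_{EHZ}(\Sigma')=\inf\{|A(\gamma)| : \gamma \text{ a closed characteristic on } \partial\Sigma'\}\in[0,\infty].$$ For an arbitrary convex body $\Sigma\subset\mathbb{R}^{2n}$ put $$\widetilde c_{EHZ}(\Sigma)=\inf\{c_{EHZ}(\Sigma')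 : \Sigma'\supset\Sigma \text{ a convex body with smooth boundary}\}.$$ Let $\mathcal E$ be the set of all $z\in W^{1,2}(S^1,\mathbb{R}^{2n})$ (absolutely continuous $2\pi$-periodic functions with $\dot z\in L_2$) such that $\int_0^{2\pi}z(t)\,dt=0$ and $\frac12\int_0^{2\pi}\langle Jz(t),\dot z(t)\rangle\,dt=1$. Proposition. Let $\Sigma\subset\mathbb{R}^{2n}$ be a convex body (not necessarily smooth) with $0$ in its interior. Then $$\widetilde c_{EHZ}(\Sigma)=\min_{z\in\mathcal E}\ \frac{\pi}{2}\int_0^{2\pi}h_\Sigma^2(\dot z(t))\,dt ;$$ in particular, the infimum of the right-hand side over $\mathcal E$ is finite and attained. -/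

import Mathlib

open scoped ContDiff

noncomputable section

namespace EHZ

open MeasureTheory Set

/-- The phase space `ℝ²ⁿ = ℝⁿ_q × ℝⁿ_p` with its Euclidean structure. The coordinate `Sum.inl i` is
`q_i` and the coordinate `Sum.inr i` is `p_i`. -/
abbrev Phase (n : ℕ) : Type := EuclideanSpace ℝ (Fin n ⊕ Fin n)

/-- The standard complex structure `J (q, p) = (-p, q)`. -/
def J {n : ℕ} (x : Phase n) : Phase n :=
  WithLp.toLp 2 (Sum.elim (fun i => -x (Sum.inr i)) (fun i => x (Sum.inl i)))

/-- The standard symplectic form `ω = ∑ dq_i ∧ dp_i`. -/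
def omega {n : ℕ} (u v : Phase n) : ℝ :=
  ∑ i : Fin n, (u (Sum.inl i) * v (Sum.inr i) - u (Sum.inr i) * v (Sum.inl i))

/-- A convex body: a compact convex set with non-empty interior. -/
structure IsConvexBody {n : ℕ} (S : Set (Phase n)) : Prop where
  convex : Convex ℝ S
  isCompact : IsCompact S
  nonempty_interior : (interior S).Nonempty

/-- `S` has smooth (`C^∞`) boundary: near each boundary point, `S` is the sublevel set
`{F ≤ 0}` of a smooth function `F` whose differential does not vanish at that point. -/
def HasSmoothBoundary {n : ℕ} (S : Set (Phase n)) : Prop :=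
  ∀ x ∈ frontier S, ∃ (U : Set (Phase n)) (F : Phase n → ℝ), IsOpen U ∧ x ∈ U ∧
    ContDiffOn ℝ ∞ F U ∧ fderiv ℝ F x ≠ 0 ∧ S ∩ U = {y ∈ U | F y ≤ 0}

/-- The support function `h_S(u) = sup {⟨x, u⟩ : x ∈ S}`. -/
def supportFn {n : ℕ} (S : Set (Phase n)) (u : Phase n) : ℝ :=
  sSup ((fun x => inner ℝ x u) '' S)

/-- The fibre at `x` of the characteristic line bundle of `∂S`, that is, the set of tangent vectors
`ξ ∈ T_x ∂S` with `ω(ξ, η) = 0` for all `η ∈ T_x ∂S`. (For a smooth hypersurface the tangent cone,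
which is taken with respect to scalars from `ℝ`, is the tangent space.) -/
def characteristicLine {n : ℕ} (S : Set (Phase n)) (x : Phase n) : Set (Phase n) :=
  {ξ ∈ tangentConeAt ℝ (frontier S) x | ∀ η ∈ tangentConeAt ℝ (frontier S) x, omega ξ η = 0}

/-- `γ` is a `2π`-periodic parametrization of a closed characteristic on `∂S`: an embedded circle in
`∂S` tangent to the characteristic line bundle. -/
structure IsClosedCharacteristic {n : ℕ} (S : Set (Phase n)) (γ : ℝ → Phase n) : Prop where
  contDiff : ContDiff ℝ ∞ γ
  periodic : Function.Periodic γ (2 * Real.pi)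
  injOn : InjOn γ (Ico 0 (2 * Real.pi))
  deriv_ne_zero : ∀ t, deriv γ t ≠ 0
  mem_frontier : ∀ t, γ t ∈ frontier S
  tangent : ∀ t, deriv γ t ∈ characteristicLine S (γ t)

/-- The action `A(γ) = ½ ∫₀^{2π} ⟨J γ(t), γ'(t)⟩ dt` of a `2π`-periodic curve. -/
def action {n : ℕ} (γ : ℝ → Phase n) : ℝ :=
  1 / 2 * ∫ t in (0 : ℝ)..(2 * Real.pi), inner ℝ (J (γ t)) (deriv γ t)

/-- The action spectrum `{|A(γ)| : γ a closed characteristic on ∂S}`. -/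
def actionSpectrum {n : ℕ} (S : Set (Phase n)) : Set ℝ :=
  {a | ∃ γ : ℝ → Phase n, IsClosedCharacteristic S γ ∧ a = |action γ|}

/-- The Ekeland-Hofer-Zehnder capacity of a convex body with smooth boundary: the least action of a
closed characteristic on its boundary. It is written as an infimum in `[0, ∞]`, so that its value
would be `∞` if there were no closed characteristic. -/
def capacityEHZ {n : ℕ} (S : Set (Phase n)) : ENNReal :=
  ⨅ a ∈ actionSpectrum S, ENNReal.ofReal a

/-- The extension of the Ekeland-Hofer-Zehnder capacity to all convex bodies: the infimum of the
capacities of the convex bodies with smooth boundary that contain `S`. -/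
def extendedCapacityEHZ {n : ℕ} (S : Set (Phase n)) : ENNReal :=
  ⨅ (S' : Set (Phase n)) (_ : IsConvexBody S' ∧ HasSmoothBoundary S' ∧ S ⊆ S'), capacityEHZ S'

/-- Membership in `W^{1,2}(S¹, ℝ²ⁿ)`: absolutely continuous `2π`-periodic functions whose (almost
everywhere defined) derivative is square integrable over a period. -/
structure IsW12Loop {n : ℕ} (z : ℝ → Phase n) : Prop where
  periodic : Function.Periodic z (2 * Real.pi)
  absolutelyContinuous : AbsolutelyContinuousOnInterval z 0 (2 * Real.pi)
  memLp_deriv : MemLp (deriv z) 2 (volume.restrict (Ioc 0 (2 * Real.pi)))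

/-- The space of `W^{1,2}` loops with mean zero and action one. -/
def loopSpace (n : ℕ) : Set (ℝ → Phase n) :=
  {z | IsW12Loop z ∧ (∫ t in (0 : ℝ)..(2 * Real.pi), z t) = 0 ∧ action z = 1}

end EHZ

end

open scoped ContDiff

noncomputable section

namespace EHZ

open MeasureTheory Set Filter Topology

variable {n : ℕ}

/-! ### The complex structure -/

/-! The proof is Clarke's dual action principle, applied in both directions.

From characteristics to loops: let γ be a closed characteristic on a smooth convex body S' ⊇ Σ,
oriented positively. Then -Jγ' is a positive multiple of the outer normal, so h_{S'}(-Jγ') ≤ ⟨Jγ,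
γ'⟩. After a reparametrization making the right side the constant A/π, where A is the action of γ,
the loop -Jγ has action A and (π/2)∫h² ≤ A². Normalizing the action to one divides by A, and h_Σ ≤
h_{S'}; so some loop in 𝓔 has dual value at most A
(`exists_supportEnergy_le_of_isClosedCharacteristic`).

From loops to characteristics: Σ lies in a smooth convex body {F ≤ 1} contained in (1+ε)Σ
(`exists_isConvexDefining`). On that body, with gauge g and H = g²/2, the direct method yields a
minimizer z, since the dual functional is weakly lower semicontinuous and the action weakly
continuous (`exists_minimizer`). If 2m is the minimum of ∫h², then z' = ∇H(mJz + c) for some c.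
Hence mJz + c is a 2π-periodic Hamiltonian orbit on one level of g; rescaled to the boundary it has
action πm, the minimal dual value. One primitive period is an embedded characteristic of no larger
action (`capacityEHZ_le`). Then ε → 0.

The body {F ≤ 1} need not be strictly convex, so h² need not be differentiable. The Euler-Lagrange
equation therefore comes from one well chosen variation, which forces equality in the Fenchel-Young
inequality almost everywhere (`exists_deriv_eq_hamGrad`). Attainment for Σ itself needs no
smoothness: `exists_minimizer` applies to it directly. -/

lemma J_inl (x : Phase n) (i : Fin n) : J x (Sum.inl i) = -x (Sum.inr i) := rfl

lemma J_inr (x : Phase n) (i : Fin n) : J x (Sum.inr i) = x (Sum.inl i) := rfl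

lemma inner_eq_sum (x y : Phase n) :
    inner ℝ x y = ∑ i, x (Sum.inl i) * y (Sum.inl i) + ∑ i, x (Sum.inr i) * y (Sum.inr i) := by
  simp [PiLp.inner_apply, Fintype.sum_sum_type, mul_comm]

lemma inner_J_eq_omega (x y : Phase n) : inner ℝ (J x) y = omega x y := by
  rw [inner_eq_sum, omega, ← Finset.sum_add_distrib]
  refine Finset.sum_congr rfl fun i _ => ?_
  rw [J_inl, J_inr]; ring

lemma J_J (x : Phase n) : J (J x) = -x := by
  ext i; rcases i with i | i <;> simp [J]

lemma inner_J_left (x y : Phase n) : inner ℝ (J x) y = -inner ℝ x (J y) := by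
  rw [inner_eq_sum, inner_eq_sum, ← Finset.sum_add_distrib, ← Finset.sum_add_distrib,
    ← Finset.sum_neg_distrib]
  refine Finset.sum_congr rfl fun i _ => ?_
  simp only [J_inl, J_inr]; ring

lemma inner_J_self (x : Phase n) : inner ℝ (J x) x = 0 := by
  have h := inner_J_left x x
  rw [real_inner_comm (J x) x] at h
  linarith

lemma inner_J_J (x y : Phase n) : inner ℝ (J x) (J y) = inner ℝ x y := by
  rw [inner_J_left, J_J, inner_neg_right, neg_neg]

lemma norm_J (x : Phase n) : ‖J x‖ = ‖x‖ := by
  rw [norm_eq_sqrt_real_inner, norm_eq_sqrt_real_inner, inner_J_J]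

/-- The complex structure as a continuous linear map. -/
def Jl (n : ℕ) : Phase n →L[ℝ] Phase n :=
  LinearMap.toContinuousLinearMap
    { toFun := J
      map_add' := fun x y => by ext i; rcases i with i | i <;> simp [J]; ring
      map_smul' := fun c x => by ext i; rcases i with i | i <;> simp [J] }

@[simp] lemma Jl_apply (x : Phase n) : Jl n x = J x := rfl

lemma J_add (x y : Phase n) : J (x + y) = J x + J y := (Jl n).map_add x y

lemma J_sub (x y : Phase n) : J (x - y) = J x - J y := (Jl n).map_sub x y

lemma J_neg (x : Phase n) : J (-x) = -J x := (Jl n).map_neg x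

lemma J_smul (c : ℝ) (x : Phase n) : J (c • x) = c • J x := (Jl n).map_smul c x

@[fun_prop] lemma continuous_J : Continuous (J : Phase n → Phase n) := (Jl n).continuous

@[fun_prop] lemma contDiff_J {k : WithTop ℕ∞} : ContDiff ℝ k (J : Phase n → Phase n) :=
  (Jl n).contDiff

lemma hasDerivAt_J {f : ℝ → Phase n} {f' : Phase n} {t : ℝ} (h : HasDerivAt f f' t) :
    HasDerivAt (fun s => J (f s)) (J f') t :=
  (Jl n).hasFDerivAt.comp_hasDerivAt t h

/-! ### Support functions -/

section Support

variable {S : Set (Phase n)}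

lemma bddAbove_inner_image (hS : IsCompact S) (u : Phase n) :
    BddAbove ((fun x => inner ℝ x u) '' S) :=
  (hS.image (by fun_prop)).bddAbove

lemma inner_le_supportFn (hS : IsCompact S) {x : Phase n} (hx : x ∈ S) (u : Phase n) :
    inner ℝ x u ≤ supportFn S u :=
  le_csSup (bddAbove_inner_image hS u) ⟨x, hx, rfl⟩

lemma supportFn_le (hne : S.Nonempty) {u : Phase n} {a : ℝ} (h : ∀ x ∈ S, inner ℝ x u ≤ a) :
    supportFn S u ≤ a := by
  refine csSup_le (hne.image _) ?_
  rintro _ ⟨x, hx, rfl⟩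
  exact h x hx

lemma supportFn_mono {S' : Set (Phase n)} (hS' : IsCompact S') (hne : S.Nonempty) (h : S ⊆ S')
    (u : Phase n) : supportFn S u ≤ supportFn S' u :=
  supportFn_le hne fun _ hx => inner_le_supportFn hS' (h hx) u

lemma supportFn_add_le (hS : IsCompact S) (hne : S.Nonempty) (u v : Phase n) :
    supportFn S (u + v) ≤ supportFn S u + supportFn S v :=
  supportFn_le hne fun x hx => by
    rw [inner_add_right]
    exact add_le_add (inner_le_supportFn hS hx u) (inner_le_supportFn hS hx v)

open scoped Pointwise in
lemma supportFn_smul {c : ℝ} (hc : 0 ≤ c) (u : Phase n) :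
    supportFn S (c • u) = c * supportFn S u := by
  have : (fun x : Phase n => inner ℝ x (c • u)) '' S = c • ((fun x => inner ℝ x u) '' S) := by
    rw [← image_smul, image_image]
    refine image_congr fun x _ => ?_
    rw [inner_smul_right, smul_eq_mul]
  rw [supportFn, this, Real.sSup_smul_of_nonneg hc]; rfl

lemma supportFn_nonneg (hS : IsCompact S) (h0 : (0 : Phase n) ∈ S) (u : Phase n) :
    0 ≤ supportFn S u := by
  simpa using inner_le_supportFn hS h0 u

lemma exists_supportFn_le_norm (hS : IsCompact S) (hne : S.Nonempty) :
    ∃ R, 0 < R ∧ (∀ x ∈ S, ‖x‖ ≤ R) ∧ ∀ u, supportFn S u ≤ R * ‖u‖ := by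
  obtain ⟨R, hR0, hR⟩ := hS.isBounded.exists_pos_norm_le
  refine ⟨R, hR0, hR, fun u => supportFn_le hne fun x hx => ?_⟩
  exact (real_inner_le_norm x u).trans (by gcongr; exact hR x hx)

/-- The point (r/‖u‖)u of a ball inside S is a competitor in the supremum. This coercivity bounds
minimizing sequences in L². -/
lemma exists_norm_le_supportFn (hS : IsCompact S) (h0 : (0 : Phase n) ∈ interior S) :
    ∃ r, 0 < r ∧ Metric.closedBall 0 r ⊆ S ∧ ∀ u, r * ‖u‖ ≤ supportFn S u := by
  obtain ⟨r, hr, hrS⟩ := Metric.nhds_basis_closedBall.mem_iff.1 (mem_interior_iff_mem_nhds.1 h0)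
  refine ⟨r, hr, hrS, fun u => ?_⟩
  by_cases hu : u = 0
  · subst hu
    simpa using inner_le_supportFn hS (interior_subset h0) 0
  · have hn : ‖u‖ ≠ 0 := norm_ne_zero_iff.2 hu
    have hmem : (r / ‖u‖) • u ∈ S := hrS (by
      rw [mem_closedBall_zero_iff, norm_smul, Real.norm_of_nonneg (by positivity)]
      field_simp; rfl)
    refine le_trans (le_of_eq ?_) (inner_le_supportFn hS hmem u)
    rw [inner_smul_left, real_inner_self_eq_norm_sq]
    simp; field_simp

lemma abs_supportFn_sub_le (hS : IsCompact S) (hne : S.Nonempty) {R : ℝ}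
    (hR : ∀ u, supportFn S u ≤ R * ‖u‖) (u v : Phase n) :
    |supportFn S u - supportFn S v| ≤ R * ‖u - v‖ := by
  have h1 := supportFn_add_le hS hne (u - v) v
  have h2 := supportFn_add_le hS hne (v - u) u
  have h3 := hR (u - v)
  have h4 := hR (v - u)
  rw [sub_add_cancel] at h1 h2
  rw [norm_sub_rev v u] at h4
  rw [abs_le]; constructor <;> linarith

/-- Makes composition with the support function a continuous map on L². -/
lemma exists_lipschitzWith_supportFn (hS : IsCompact S) (hne : S.Nonempty) :
    ∃ K, LipschitzWith K (supportFn S) := by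
  obtain ⟨R, hR0, -, hR⟩ := exists_supportFn_le_norm hS hne
  refine ⟨⟨R, hR0.le⟩, LipschitzWith.of_dist_le_mul fun u v => ?_⟩
  rw [Real.dist_eq, dist_eq_norm]
  exact abs_supportFn_sub_le hS hne hR u v

lemma supportFn_zero (hne : S.Nonempty) : supportFn S 0 = 0 := by
  simp [supportFn, hne.image_const]

end Support

/-! ### Absolutely continuous vector-valued functions -/

lemma _root_.AbsolutelyContinuousOnInterval.clm_comp {E F : Type*} [NormedAddCommGroup E]
    [NormedSpace ℝ E] [NormedAddCommGroup F] [NormedSpace ℝ F] {f : ℝ → E} {a b : ℝ}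
    (hf : AbsolutelyContinuousOnInterval f a b) (L : E →L[ℝ] F) :
    AbsolutelyContinuousOnInterval (fun t => L (f t)) a b := by
  refine squeeze_zero (fun t => Finset.sum_nonneg fun i _ => dist_nonneg) (fun t => ?_)
    (by simpa using Tendsto.const_mul ‖L‖ hf)
  rw [Finset.mul_sum]
  refine Finset.sum_le_sum fun i _ => ?_
  rw [dist_eq_norm, dist_eq_norm, ← map_sub]
  exact L.le_opNorm _

lemma _root_.AbsolutelyContinuousOnInterval.congr_of_eqOn {X : Type*} [PseudoMetricSpace X]
    {f g : ℝ → X} {a b : ℝ} (hf : AbsolutelyContinuousOnInterval f a b)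
    (h : EqOn f g (uIcc a b)) : AbsolutelyContinuousOnInterval g a b := by
  refine Tendsto.congr' ?_ hf
  refine mem_inf_of_right (mem_principal.2 fun E hE => Finset.sum_congr rfl fun i hi => ?_)
  rw [h (hE.1 i hi).1, h (hE.1 i hi).2]

lemma absolutelyContinuousOnInterval_const {X : Type*} [PseudoMetricSpace X] (c : X) (a b : ℝ) :
    AbsolutelyContinuousOnInterval (fun _ => c) a b :=
  (LipschitzWith.const c).lipschitzOnWith.absolutelyContinuousOnInterval

lemma absolutelyContinuousOnInterval_sum {E ι : Type*} [NormedAddCommGroup E] {f : ι → ℝ → E}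
    {a b : ℝ} (s : Finset ι) (h : ∀ i ∈ s, AbsolutelyContinuousOnInterval (f i) a b) :
    AbsolutelyContinuousOnInterval (fun t => ∑ i ∈ s, f i t) a b := by
  classical
  induction s using Finset.induction_on with
  | empty => simpa using absolutelyContinuousOnInterval_const (0 : E) a b
  | insert i s hi ih =>
    simp only [Finset.sum_insert hi]
    exact (h i (Finset.mem_insert_self i s)).fun_add
      (ih fun j hj => h j (Finset.mem_insert_of_mem hj))

/-- Coordinates reduce almost everywhere differentiability and the fundamental theorem of calculus
to real-valued functions. -/
lemma _root_.AbsolutelyContinuousOnInterval.coord {f : ℝ → Phase n} {a b : ℝ}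
    (hf : AbsolutelyContinuousOnInterval f a b) (i : Fin n ⊕ Fin n) :
    AbsolutelyContinuousOnInterval (fun t => f t i) a b :=
  hf.clm_comp (EuclideanSpace.proj i)

lemma absolutelyContinuousOnInterval_of_coord {f : ℝ → Phase n} {a b : ℝ}
    (hf : ∀ i, AbsolutelyContinuousOnInterval (fun t => f t i) a b) :
    AbsolutelyContinuousOnInterval f a b := by
  have h : f = fun t => ∑ i, f t i • EuclideanSpace.single i (1 : ℝ) := by
    funext t
    ext j
    rw [WithLp.ofLp_sum, Finset.sum_apply, Finset.sum_eq_single j] <;>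
      simp +contextual [eq_comm]
  rw [h]
  exact absolutelyContinuousOnInterval_sum _ fun i _ =>
    (hf i).fun_smul (absolutelyContinuousOnInterval_const _ a b)

lemma _root_.AbsolutelyContinuousOnInterval.inner_phase {f g : ℝ → Phase n} {a b : ℝ}
    (hf : AbsolutelyContinuousOnInterval f a b) (hg : AbsolutelyContinuousOnInterval g a b) :
    AbsolutelyContinuousOnInterval (fun t => inner ℝ (f t) (g t)) a b := by
  have h : (fun t => inner ℝ (f t) (g t)) = fun t => ∑ i, f t i * g t i := by
    funext t
    simp [PiLp.inner_apply, mul_comm]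
  rw [h]
  exact absolutelyContinuousOnInterval_sum _ fun i _ => (hf.coord i).fun_mul (hg.coord i)

lemma hasDerivAt_of_coord {f : ℝ → Phase n} {t : ℝ}
    (h : ∀ i, DifferentiableAt ℝ (fun s => f s i) t) : HasDerivAt f (deriv f t) t :=
  (differentiableAt_euclidean.2 h).hasDerivAt

lemma _root_.AbsolutelyContinuousOnInterval.ae_hasDerivAt {f : ℝ → Phase n} {a b : ℝ}
    (hf : AbsolutelyContinuousOnInterval f a b) :
    ∀ᵐ t, t ∈ uIcc a b → HasDerivAt f (deriv f t) t := by
  filter_upwards [ae_all_iff.2 fun i => (hf.coord i).ae_differentiableAt] with t ht hmem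
  exact hasDerivAt_of_coord fun i => ht i hmem

lemma coord_intervalIntegral {f : ℝ → Phase n} {a b : ℝ} (hf : IntervalIntegrable f volume a b)
    (i : Fin n ⊕ Fin n) : (∫ t in a..b, f t) i = ∫ t in a..b, f t i :=
  ((EuclideanSpace.proj (𝕜 := ℝ) i).intervalIntegral_comp_comm hf).symm

lemma intervalIntegrable_coord {f : ℝ → Phase n} {a b : ℝ} (hf : IntervalIntegrable f volume a b)
    (i : Fin n ⊕ Fin n) : IntervalIntegrable (fun t => f t i) volume a b := by
  rw [intervalIntegrable_iff] at hf ⊢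
  exact (EuclideanSpace.proj (𝕜 := ℝ) i).integrable_comp hf

lemma _root_.AbsolutelyContinuousOnInterval.integral_deriv_phase {f : ℝ → Phase n} {a b : ℝ}
    (hf : AbsolutelyContinuousOnInterval f a b) (hi : IntervalIntegrable (deriv f) volume a b) :
    ∫ t in a..b, deriv f t = f b - f a := by
  ext i
  rw [coord_intervalIntegral hi, PiLp.sub_apply, ← (hf.coord i).integral_deriv_eq_sub]
  refine intervalIntegral.integral_congr_ae ?_
  filter_upwards [hf.ae_hasDerivAt] with t ht hmem
  exact ((EuclideanSpace.proj (𝕜 := ℝ) i).hasFDerivAt.comp_hasDerivAt t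
    (ht (uIoc_subset_uIcc hmem))).deriv.symm

lemma absolutelyContinuousOnInterval_primitive {f : ℝ → Phase n} {a b : ℝ}
    (hf : IntervalIntegrable f volume a b) :
    AbsolutelyContinuousOnInterval (fun t => ∫ s in a..t, f s) a b := by
  refine absolutelyContinuousOnInterval_of_coord fun i => ?_
  have h := (intervalIntegrable_coord hf i).absolutelyContinuousOnInterval_intervalIntegral
    (c := a) left_mem_uIcc
  exact h.congr_of_eqOn fun t ht =>
    (coord_intervalIntegral (hf.mono_set (uIcc_subset_uIcc_left ht)) i).symm

/-! ### Loops of class `W^{1,2}` -/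

/-- Lebesgue measure on a period. -/
abbrev circ : Measure ℝ := volume.restrict (Ioc 0 (2 * Real.pi))

lemma integral_circ {E : Type*} [NormedAddCommGroup E] [NormedSpace ℝ E] (f : ℝ → E) :
    ∫ t in (0 : ℝ)..(2 * Real.pi), f t = ∫ t, f t ∂circ :=
  intervalIntegral.integral_of_le Real.two_pi_pos.le

lemma intervalIntegrable_iff_circ {E : Type*} [NormedAddCommGroup E] {f : ℝ → E} :
    IntervalIntegrable f volume 0 (2 * Real.pi) ↔ Integrable f circ :=
  intervalIntegrable_iff_integrableOn_Ioc_of_le Real.two_pi_pos.le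

lemma integrable_circ_of_continuous {E : Type*} [NormedAddCommGroup E] {f : ℝ → E}
    (hf : Continuous f) : Integrable f circ :=
  intervalIntegrable_iff_circ.1 (hf.intervalIntegrable _ _)

lemma memLp_circ_of_continuous {f : ℝ → Phase n} (hf : Continuous f) : MemLp f 2 circ := by
  obtain ⟨C, hC⟩ := isCompact_Icc.exists_bound_of_continuousOn (hf.continuousOn (s := Icc 0 (2 * Real.pi)))
  refine MemLp.of_bound hf.aestronglyMeasurable C ?_
  filter_upwards [ae_restrict_mem measurableSet_Ioc] with t ht
  exact hC t (Ioc_subset_Icc_self ht)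

lemma ae_circ_of_ae_uIcc {p : ℝ → Prop}
    (h : ∀ᵐ t, t ∈ uIcc 0 (2 * Real.pi) → p t) : ∀ᵐ t ∂circ, p t := by
  rw [ae_restrict_iff' measurableSet_Ioc]
  filter_upwards [h] with t ht hmem
  exact ht (by rw [uIcc_of_le Real.two_pi_pos.le]; exact Ioc_subset_Icc_self hmem)

lemma ae_circ_mem_Ioo : ∀ᵐ t ∂circ, t ∈ Ioo 0 (2 * Real.pi) := by
  have h1 : ∀ᵐ t ∂circ, t ≠ 2 * Real.pi :=
    ae_restrict_of_ae (Measure.ae_ne volume _)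
  filter_upwards [h1, ae_restrict_mem measurableSet_Ioc] with t ht hmem
  exact ⟨hmem.1, lt_of_le_of_ne hmem.2 ht⟩

lemma periodic_eq_of_eqOn_Icc {α : Type*} {f g : ℝ → α} (hf : Function.Periodic f (2 * Real.pi))
    (hg : Function.Periodic g (2 * Real.pi)) (h : EqOn f g (Icc 0 (2 * Real.pi))) : f = g := by
  funext t
  have h1 := toIcoMod_mem_Ico Real.two_pi_pos 0 t
  rw [zero_add] at h1
  have h2 := h (Ico_subset_Icc_self h1)
  rw [toIcoMod, hf.sub_zsmul_eq, hg.sub_zsmul_eq] at h2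
  exact h2

lemma action_eq (z : ℝ → Phase n) :
    action z = 1 / 2 * ∫ t, inner ℝ (J (z t)) (deriv z t) ∂circ := by
  rw [action, integral_circ]

section Loops

variable {z y : ℝ → Phase n}

/-- Absolute continuity gives continuity on one closed period only; equal end values let the
function descend to the circle. -/
lemma IsW12Loop.continuous (hz : IsW12Loop z) : Continuous z := by
  have : Fact (0 < 2 * Real.pi) := ⟨Real.two_pi_pos⟩
  have hc : ContinuousOn z (Icc 0 (2 * Real.pi)) := by
    rw [← uIcc_of_le Real.two_pi_pos.le]
    exact hz.absolutelyContinuous.continuousOn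
  have h0 : z 0 = z (2 * Real.pi) := by
    simpa using (hz.periodic 0).symm
  have h1 := AddCircle.liftIco_zero_continuous h0 hc
  have h2 : z = (AddCircle.liftIco (2 * Real.pi) 0 z) ∘ ((↑) : ℝ → AddCircle (2 * Real.pi)) := by
    refine periodic_eq_of_eqOn_Icc hz.periodic (fun t => ?_) fun t ht => ?_
    · simp
    · rcases eq_or_lt_of_le ht.2 with h | h
      · rw [h, ← h0, Function.comp_apply, AddCircle.coe_period, ← AddCircle.coe_zero,
          AddCircle.liftIco_zero_coe_apply ⟨le_rfl, Real.two_pi_pos⟩]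
      · rw [Function.comp_apply, AddCircle.liftIco_zero_coe_apply ⟨ht.1, h⟩]
  rw [h2]
  exact h1.comp (AddCircle.continuous_mk' _)

lemma IsW12Loop.integrable_deriv (hz : IsW12Loop z) : Integrable (deriv z) circ :=
  hz.memLp_deriv.integrable (by norm_num)

lemma IsW12Loop.ae_hasDerivAt (hz : IsW12Loop z) : ∀ᵐ t ∂circ, HasDerivAt z (deriv z t) t :=
  ae_circ_of_ae_uIcc hz.absolutelyContinuous.ae_hasDerivAt

lemma IsW12Loop.integral_deriv (hz : IsW12Loop z) {t : ℝ} (ht : t ∈ Icc 0 (2 * Real.pi)) :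
    ∫ s in 0..t, deriv z s = z t - z 0 := by
  have hsub : uIcc 0 t ⊆ uIcc 0 (2 * Real.pi) :=
    uIcc_subset_uIcc_left (by rwa [uIcc_of_le Real.two_pi_pos.le])
  exact (hz.absolutelyContinuous.mono hsub).integral_deriv_phase
    ((intervalIntegrable_iff_circ.2 hz.integrable_deriv).mono_set hsub)

lemma IsW12Loop.integral_deriv_circ (hz : IsW12Loop z) : ∫ t, deriv z t ∂circ = 0 := by
  rw [← integral_circ, hz.integral_deriv ⟨Real.two_pi_pos.le, le_rfl⟩, sub_eq_zero]
  simpa using hz.periodic 0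

lemma IsW12Loop.of_contDiff (hz : ContDiff ℝ 1 z) (hp : Function.Periodic z (2 * Real.pi)) :
    IsW12Loop z where
  periodic := hp
  absolutelyContinuous := hz.contDiffOn.absolutelyContinuousOnInterval
  memLp_deriv := memLp_circ_of_continuous (hz.continuous_deriv le_rfl)

lemma IsW12Loop.add_smul (hz : IsW12Loop z) (hy : IsW12Loop y) (s : ℝ) :
    IsW12Loop (fun t => z t + s • y t) ∧
      ∀ᵐ t ∂circ, deriv (fun t => z t + s • y t) t = deriv z t + s • deriv y t := by
  have hd : ∀ᵐ t ∂circ, deriv (fun t => z t + s • y t) t = deriv z t + s • deriv y t := by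
    filter_upwards [hz.ae_hasDerivAt, hy.ae_hasDerivAt] with t h1 h2
    exact (h1.add (h2.const_smul s)).deriv
  refine ⟨⟨fun t => by simp only [hz.periodic t, hy.periodic t], ?_, ?_⟩, hd⟩
  · exact hz.absolutelyContinuous.fun_add (hy.absolutelyContinuous.const_smul s)
  · exact (memLp_congr_ae hd).2 (hz.memLp_deriv.add (hy.memLp_deriv.const_smul s))

lemma integrable_inner_circ {f g : ℝ → Phase n} (hf : MemLp f 2 circ) (hg : MemLp g 2 circ) :
    Integrable (fun t => inner ℝ (f t) (g t)) circ :=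
  (L2.integrable_inner (𝕜 := ℝ) (hf.toLp f) (hg.toLp g)).congr <| by
    filter_upwards [hf.coeFn_toLp, hg.coeFn_toLp] with t h1 h2
    rw [h1, h2]

lemma memLp_J {f : ℝ → Phase n} (hf : MemLp f 2 circ) : MemLp (fun t => J (f t)) 2 circ :=
  (Jl n).comp_memLp' hf

/-- Integrate the derivative of ⟨Jy, z⟩ over a period: the boundary terms cancel, and ⟨Jy', z⟩ =
-⟨Jz, y'⟩. -/
lemma IsW12Loop.integral_inner_J_comm (hz : IsW12Loop z) (hy : IsW12Loop y) :
    ∫ t, inner ℝ (J (y t)) (deriv z t) ∂circ = ∫ t, inner ℝ (J (z t)) (deriv y t) ∂circ := by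
  have hJ := hy.absolutelyContinuous.clm_comp (Jl n)
  have h1 := (hJ.inner_phase hz.absolutelyContinuous).integral_deriv_eq_sub
  have h2 : inner ℝ (Jl n (y (2 * Real.pi))) (z (2 * Real.pi)) = inner ℝ (Jl n (y 0)) (z 0) := by
    have hz0 := hz.periodic 0
    have hy0 := hy.periodic 0
    rw [zero_add] at hz0 hy0
    rw [hz0, hy0]
  rw [h2, sub_self, integral_circ] at h1
  rw [← sub_eq_zero, ← integral_sub]
  · rw [← h1]
    refine integral_congr_ae ?_
    filter_upwards [hz.ae_hasDerivAt, hy.ae_hasDerivAt] with t h3 h4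
    simp only [Jl_apply]
    rw [((hasDerivAt_J h4).inner ℝ h3).deriv, inner_J_left (deriv y t), real_inner_comm (deriv y t)]
    ring
  · exact integrable_inner_circ (memLp_J (memLp_circ_of_continuous hy.continuous)) hz.memLp_deriv
  · exact integrable_inner_circ (memLp_J (memLp_circ_of_continuous hz.continuous)) hy.memLp_deriv

lemma IsW12Loop.integrable_action (hz : IsW12Loop z) (hy : IsW12Loop y) :
    Integrable (fun t => inner ℝ (J (z t)) (deriv y t)) circ :=
  integrable_inner_circ (memLp_J (memLp_circ_of_continuous hz.continuous)) hy.memLp_deriv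

lemma IsW12Loop.action_add_smul (hz : IsW12Loop z) (hy : IsW12Loop y) (s : ℝ) :
    action (fun t => z t + s • y t) =
      action z + s * ∫ t, inner ℝ (J (z t)) (deriv y t) ∂circ + s ^ 2 * action y := by
  have h1 : ∫ t, inner ℝ (J (z t + s • y t)) (deriv (fun t => z t + s • y t) t) ∂circ =
      ∫ t, (inner ℝ (J (z t)) (deriv z t) + s * inner ℝ (J (z t)) (deriv y t)) +
        (s * inner ℝ (J (y t)) (deriv z t) + s ^ 2 * inner ℝ (J (y t)) (deriv y t)) ∂circ := by
    refine integral_congr_ae ?_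
    filter_upwards [(hz.add_smul hy s).2] with t ht
    rw [ht, J_add, J_smul, inner_add_left, inner_add_right, inner_add_right,
      real_inner_smul_left, real_inner_smul_left, real_inner_smul_right, real_inner_smul_right]
    ring
  have i1 := hz.integrable_action hz
  have i2 := (hz.integrable_action hy).const_mul s
  have i3 := (hy.integrable_action hz).const_mul s
  have i4 := (hy.integrable_action hy).const_mul (s ^ 2)
  rw [action_eq, h1, integral_add (i1.fun_add i2) (i3.fun_add i4), integral_add i1 i2, integral_add i3 i4,
    integral_const_mul, integral_const_mul, integral_const_mul, hz.integral_inner_J_comm hy,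
    action_eq, action_eq]
  ring

/-- A loop of positive action becomes an element of `loopSpace` after translation and scaling. -/
lemma IsW12Loop.exists_mem_loopSpace (hy : IsW12Loop y) (hA : 0 < action y) :
    ∃ z ∈ loopSpace n, ∀ t, deriv z t = (√(action y))⁻¹ • deriv y t := by
  set c := (√(action y))⁻¹ with hc
  set a : Phase n := (2 * Real.pi)⁻¹ • ∫ t, y t ∂circ with ha
  have hcA : c ^ 2 * action y = 1 := by
    rw [hc, inv_pow, Real.sq_sqrt hA.le, inv_mul_cancel₀ hA.ne']
  have hd : ∀ t, deriv (fun t => c • (y t - a)) t = c • deriv y t := fun t => by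
    rw [deriv_fun_const_smul_field, deriv_sub_const]
  refine ⟨fun t => c • (y t - a), ⟨⟨fun t => by simp only [hy.periodic t], ?_, ?_⟩, ?_, ?_⟩, hd⟩
  · exact (hy.absolutelyContinuous.fun_sub (absolutelyContinuousOnInterval_const a _ _)).const_smul c
  · rw [funext hd]
    exact hy.memLp_deriv.const_smul c
  · rw [integral_circ, integral_smul, integral_sub (integrable_circ_of_continuous hy.continuous)
      (integrable_const a)]
    simp only [integral_const, measureReal_restrict_apply_univ, Real.volume_real_Ioc, sub_zero]
    rw [max_eq_left Real.two_pi_pos.le, ha, smul_inv_smul₀ Real.two_pi_pos.ne', sub_self, smul_zero]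
  · rw [action_eq]
    simp only [hd, J_smul, J_sub, real_inner_smul_left, real_inner_smul_right, inner_sub_left]
    -- The translation by `a` does not affect the action because the derivative has mean zero.
    rw [integral_const_mul, integral_const_mul, integral_sub (hy.integrable_action hy)
      (hy.integrable_deriv.const_inner _), integral_inner hy.integrable_deriv,
      hy.integral_deriv_circ, inner_zero_right, sub_zero]
    rw [action_eq] at hcA
    linear_combination hcA

/-- A square integrable function of mean zero is the derivative of a loop. -/
lemma exists_isW12Loop_deriv_eq {w : ℝ → Phase n} (hw : MemLp w 2 circ)
    (h0 : ∫ t, w t ∂circ = 0) :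
    ∃ z, IsW12Loop z ∧ deriv z =ᵐ[circ] w ∧
      ∀ t ∈ Icc 0 (2 * Real.pi), z t = ∫ s in 0..t, w s := by
  -- The primitive on one period, extended periodically; mean zero makes it also correct at the
  -- right end point 2π.
  set z : ℝ → Phase n := fun t => ∫ s in 0..(toIcoMod Real.two_pi_pos 0 t), w s with hz
  have hwi : IntervalIntegrable w volume 0 (2 * Real.pi) :=
    intervalIntegrable_iff_circ.2 (hw.integrable (by norm_num))
  have hIcc : ∀ t ∈ Icc 0 (2 * Real.pi), z t = ∫ s in 0..t, w s := fun t ht => by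
    rcases eq_or_lt_of_le ht.2 with h | h
    · have h2 : toIcoMod Real.two_pi_pos 0 (2 * Real.pi) = 0 := by
        simpa using toIcoMod_apply_right Real.two_pi_pos 0
      simp only [hz, h, h2]
      rw [integral_circ, h0, intervalIntegral.integral_same]
    · simp only [hz]
      rw [(toIcoMod_eq_self Real.two_pi_pos).2 ⟨ht.1, by simpa using h⟩]
  have hder : deriv z =ᵐ[circ] w := by
    filter_upwards [ae_circ_mem_Ioo, ae_circ_of_ae_uIcc hwi.ae_hasDerivAt_integral] with t ht h
    have h1 := h 0 left_mem_uIcc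
    refine (h1.congr_of_eventuallyEq ?_).deriv
    filter_upwards [Ioo_mem_nhds ht.1 ht.2] with s hs
    exact hIcc s (Ioo_subset_Icc_self hs)
  refine ⟨z, ⟨fun t => ?_, ?_, (memLp_congr_ae hder).2 hw⟩, hder, hIcc⟩
  · simp only [hz, toIcoMod_add_right]
  · refine (absolutelyContinuousOnInterval_primitive hwi).congr_of_eqOn fun t ht => ?_
    rw [uIcc_of_le Real.two_pi_pos.le] at ht
    exact (hIcc t ht).symm

end Loops

/-! ### Weak sequential compactness -/

/-- Sequential Banach-Alaoglu in the separable dual ball, transported by the Riesz isomorphism. -/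
lemma exists_weak_limit {X : Type*} [NormedAddCommGroup X] [InnerProductSpace ℝ X] [CompleteSpace X]
    [TopologicalSpace.SeparableSpace X] {w : ℕ → X} {C : ℝ} (hw : ∀ k, ‖w k‖ ≤ C) :
    ∃ (v : X) (φ : ℕ → ℕ), StrictMono φ ∧
      ∀ u, Tendsto (fun k => inner ℝ u (w (φ k))) atTop (𝓝 (inner ℝ u v)) := by
  obtain ⟨f, -, φ, hφ, h⟩ := WeakDual.isSeqCompact_closedBall ℝ X 0 C
    (x := fun k => StrongDual.toWeakDual (InnerProductSpace.toDual ℝ X (w k))) (fun k => by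
      simpa using hw k)
  refine ⟨(InnerProductSpace.toDual ℝ X).symm (WeakDual.toStrongDual f), φ, hφ, fun u => ?_⟩
  have h1 := ((WeakDual.eval_continuous u).tendsto f).comp h
  rw [real_inner_comm, InnerProductSpace.toDual_symm_apply]
  refine h1.congr fun k => ?_
  rw [real_inner_comm]
  rfl

instance : Fact ((2 : ENNReal) ≠ ⊤) := ⟨by norm_num⟩

/-! ### The dual functional -/

/-- The functional `∫₀^{2π} h_S²(f)`. -/
def supportEnergy (S : Set (Phase n)) (f : ℝ → Phase n) : ℝ :=
  ∫ t, supportFn S (f t) ^ 2 ∂circ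

section

variable {S : Set (Phase n)}

lemma supportEnergy_nonneg (f : ℝ → Phase n) : 0 ≤ supportEnergy S f :=
  integral_nonneg fun _ => sq_nonneg _

lemma supportEnergy_congr {f g : ℝ → Phase n} (h : f =ᵐ[circ] g) :
    supportEnergy S f = supportEnergy S g :=
  integral_congr_ae <| by filter_upwards [h] with t ht; rw [ht]

lemma supportEnergy_smul {c : ℝ} (hc : 0 ≤ c) (f : ℝ → Phase n) :
    supportEnergy S (fun t => c • f t) = c ^ 2 * supportEnergy S f := by
  rw [supportEnergy, supportEnergy, ← integral_const_mul]
  refine integral_congr_ae (ae_of_all _ fun t => ?_)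
  simp only [supportFn_smul hc, mul_pow]

lemma memLp_supportFn (hS : IsCompact S) (hne : S.Nonempty) {f : ℝ → Phase n}
    (hf : MemLp f 2 circ) : MemLp (fun t => supportFn S (f t)) 2 circ :=
  (exists_lipschitzWith_supportFn hS hne).choose_spec.comp_memLp (supportFn_zero hne) hf

lemma integrable_supportFn_sq (hS : IsCompact S) (hne : S.Nonempty) {f : ℝ → Phase n}
    (hf : MemLp f 2 circ) : Integrable (fun t => supportFn S (f t) ^ 2) circ :=
  (memLp_supportFn hS hne hf).integrable_sq

lemma supportEnergy_mono {f g : ℝ → Phase n} {S' : Set (Phase n)} (hS : IsCompact S)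
    (h0 : 0 ∈ S) (hS' : IsCompact S') (hne' : S'.Nonempty) (hf : MemLp f 2 circ)
    (hg : MemLp g 2 circ) (h : ∀ᵐ t ∂circ, supportFn S (f t) ≤ supportFn S' (g t)) :
    supportEnergy S f ≤ supportEnergy S' g := by
  refine integral_mono_ae (integrable_supportFn_sq hS ⟨0, h0⟩ hf)
    (integrable_supportFn_sq hS' hne' hg) ?_
  filter_upwards [h] with t ht
  exact pow_le_pow_left₀ (supportFn_nonneg hS h0 _) ht 2

lemma convex_supportEnergy_le (hS : IsCompact S) (h0 : 0 ∈ S) (c : ℝ) :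
    Convex ℝ {v : Lp (Phase n) 2 circ | supportEnergy S v ≤ c} := by
  intro u hu v hv a b ha hb hab
  have hi : ∀ w : Lp (Phase n) 2 circ, Integrable (fun t => supportFn S (w t) ^ 2) circ :=
    fun w => integrable_supportFn_sq hS ⟨0, h0⟩ (Lp.memLp w)
  have h1 : supportEnergy S (a • u + b • v : Lp (Phase n) 2 circ) ≤
      a * supportEnergy S u + b * supportEnergy S v := by
    rw [supportEnergy, supportEnergy, supportEnergy, ← integral_const_mul, ← integral_const_mul,
      ← integral_add ((hi u).const_mul a) ((hi v).const_mul b)]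
    refine integral_mono_ae (hi _) (((hi u).const_mul a).add ((hi v).const_mul b)) ?_
    filter_upwards [Lp.coeFn_add (a • u) (b • v), Lp.coeFn_smul a u, Lp.coeFn_smul b v]
      with t h1 h2 h3
    rw [h1, Pi.add_apply, h2, h3, Pi.smul_apply, Pi.smul_apply]
    have h4 : supportFn S (a • u t + b • v t) ≤ a * supportFn S (u t) + b * supportFn S (v t) := by
      rw [← supportFn_smul ha, ← supportFn_smul hb]
      exact supportFn_add_le hS ⟨0, h0⟩ _ _
    refine (pow_le_pow_left₀ (supportFn_nonneg hS h0 _) h4 2).trans ?_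
    obtain rfl : b = 1 - a := by linarith
    -- The convexity defect of the square is ab(p - q)² for a + b = 1.
    nlinarith [mul_nonneg (mul_nonneg ha hb) (sq_nonneg (supportFn S (u t) - supportFn S (v t)))]
  have h2 : a * supportEnergy S u + b * supportEnergy S v ≤ a * c + b * c := by
    gcongr
    · exact hu
    · exact hv
  rw [← add_mul, hab, one_mul] at h2
  exact h1.trans h2

/-- The energy is the squared L² norm of the support function composed with v, and that composition
is continuous in v. -/
lemma isClosed_supportEnergy_le (hS : IsCompact S) (h0 : 0 ∈ S) (c : ℝ) :
    IsClosed {v : Lp (Phase n) 2 circ | supportEnergy S v ≤ c} := by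
  obtain ⟨K, hK⟩ := exists_lipschitzWith_supportFn hS ⟨0, h0⟩
  have hz : supportFn S 0 = 0 := supportFn_zero ⟨0, h0⟩
  have h : ∀ v : Lp (Phase n) 2 circ, supportEnergy S v = inner ℝ (hK.compLp hz v) (hK.compLp hz v) := by
    intro v
    rw [L2.inner_def]
    refine integral_congr_ae ?_
    filter_upwards [hK.coeFn_compLp hz v] with t ht
    rw [ht]
    simp [sq]
  simp only [h]
  have := hK.continuous_compLp (μ := circ) (p := 2) hz
  exact isClosed_le (this.inner this) continuous_const

/-- Sublevel sets are convex and closed, hence weakly closed: a limit outside one would be separated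
from it by a functional. -/
lemma supportEnergy_le_of_weak_limit (hS : IsCompact S) (h0 : 0 ∈ S)
    {w : ℕ → Lp (Phase n) 2 circ} {v : Lp (Phase n) 2 circ} {α : ℝ}
    (hw : ∀ u, Tendsto (fun k => inner ℝ u (w k)) atTop (𝓝 (inner ℝ u v)))
    (hα : Tendsto (fun k => supportEnergy S (w k)) atTop (𝓝 α)) : supportEnergy S v ≤ α := by
  refine le_of_forall_gt_imp_ge_of_dense fun c hc => ?_
  by_contra hv
  obtain ⟨f, u, hu, huv⟩ := geometric_hahn_banach_closed_point
    (convex_supportEnergy_le hS h0 c) (isClosed_supportEnergy_le hS h0 c) hv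
  have h1 : Tendsto (fun k => f (w k)) atTop (𝓝 (f v)) := by
    have := hw ((InnerProductSpace.toDual ℝ _).symm f)
    simpa only [InnerProductSpace.toDual_symm_apply] using this
  obtain ⟨k, hk1, hk2⟩ := ((h1.eventually (lt_mem_nhds huv)).and
    (hα.eventually (gt_mem_nhds hc))).exists
  exact absurd (hu (w k) hk2.le) (not_lt.2 hk1.le)

end

/-! ### A loop of action one -/

/-- The unit circle in the plane of e and Je has action π; n ≥ 1 supplies e. -/
lemma loopSpace_nonempty (hn : 1 ≤ n) : (loopSpace n).Nonempty := by
  set e : Phase n := EuclideanSpace.single (Sum.inl ⟨0, hn⟩) 1 with he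
  have hen : ‖e‖ = 1 := by simp [he]
  set z : ℝ → Phase n := fun t => Real.cos t • e + Real.sin t • J e with hz
  have hd : ∀ t, HasDerivAt z (J (z t)) t := fun t => by
    have h := ((Real.hasDerivAt_cos t).smul_const e).add ((Real.hasDerivAt_sin t).smul_const (J e))
    refine h.congr_deriv ?_
    simp only [hz, J_add, J_smul, J_J]
    module
  have hc : ContDiff ℝ 1 z :=
    (Real.contDiff_cos.smul contDiff_const).add (Real.contDiff_sin.smul contDiff_const)
  have hl : IsW12Loop z := .of_contDiff hc fun t => by simp [hz]
  have ha : action z = Real.pi := by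
    have h1 : ∀ t, inner ℝ (J (z t)) (deriv z t) = 1 := fun t => by
      rw [(hd t).deriv, inner_J_J]
      simp only [hz, inner_add_left, inner_add_right, real_inner_smul_left, real_inner_smul_right,
        inner_J_self, real_inner_comm (J e) e, real_inner_self_eq_norm_sq, norm_smul, norm_J, hen,
        Real.norm_eq_abs, mul_one, sq_abs, mul_zero, add_zero, zero_add, Real.cos_sq_add_sin_sq]
    simp only [action, h1]
    simp
  obtain ⟨y, hy, -⟩ := hl.exists_mem_loopSpace (by rw [ha]; exact Real.pi_pos)
  exact ⟨y, hy⟩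

/-! ### Existence of minimizers -/

/-- Since u' has mean zero the base point drops out. The action thus depends on u' alone, the
quantity that converges weakly. -/
lemma action_eq_inner_primitive {u : ℝ → Phase n} (hu : IsW12Loop u) :
    action u = 1 / 2 * ∫ t, inner ℝ (J (u t - u 0)) (deriv u t) ∂circ := by
  have h : ∫ t, inner ℝ (J (u 0)) (deriv u t) ∂circ = 0 := by
    rw [integral_inner hu.integrable_deriv, hu.integral_deriv_circ, inner_zero_right]
  simp only [J_sub, inner_sub_left]
  rw [action_eq, integral_sub (hu.integrable_action hu) (hu.integrable_deriv.const_inner _), h,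
    sub_zero]

/-- The action is continuous under weak convergence of the derivatives. -/
lemma tendsto_action_of_weak {u : ℕ → ℝ → Phase n} (hu : ∀ k, IsW12Loop (u k))
    {z : ℝ → Phase n} (hz : IsW12Loop z) {C : ℝ}
    (hC : ∀ k, ‖(hu k).memLp_deriv.toLp (deriv (u k))‖ ≤ C)
    (hw : ∀ v : Lp (Phase n) 2 circ,
      Tendsto (fun k => inner ℝ v ((hu k).memLp_deriv.toLp (deriv (u k)))) atTop
        (𝓝 (inner ℝ v (hz.memLp_deriv.toLp (deriv z))))) :
    Tendsto (fun k => action (u k)) atTop (𝓝 (action z)) := by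
  set w := fun k => (hu k).memLp_deriv.toLp (deriv (u k)) with hwdef
  set D : ℕ → ℝ → Phase n := fun k t => (u k t - u k 0) - (z t - z 0) with hD
  have hDc : ∀ k, Continuous (D k) := fun k =>
    ((hu k).continuous.sub continuous_const).sub (hz.continuous.sub continuous_const)
  -- Testing y' against c times the indicator of (0, t] evaluates the primitive, so weak convergence
  -- gives pointwise convergence of primitives.
  have hset : ∀ (y : ℝ → Phase n) (hy : IsW12Loop y) (t : ℝ) (ht : t ∈ Icc 0 (2 * Real.pi))
      (c : Phase n),
      inner ℝ (indicatorConstLp 2 (μ := circ) (measurableSet_Ioc (a := 0) (b := t))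
        (measure_ne_top _ _) c) (hy.memLp_deriv.toLp (deriv y)) = inner ℝ c (y t - y 0) := by
    intro y hy t ht c
    rw [L2.inner_indicatorConstLp_eq_inner_setIntegral]
    congr 1
    rw [setIntegral_congr_ae (g := deriv y) measurableSet_Ioc
      (hy.memLp_deriv.coeFn_toLp.mono fun t ht _ => ht), Measure.restrict_restrict measurableSet_Ioc,
      inter_eq_left.2 (Ioc_subset_Ioc_right ht.2), ← intervalIntegral.integral_of_le ht.1,
      hy.integral_deriv ht]
  have hpt : ∀ t ∈ Icc 0 (2 * Real.pi), Tendsto (fun k => D k t) atTop (𝓝 0) := by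
    intro t ht
    have h1 : Tendsto (fun k => u k t - u k 0) atTop (𝓝 (z t - z 0)) := by
      rw [(EuclideanSpace.equiv (Fin n ⊕ Fin n) ℝ).toHomeomorph.isInducing.tendsto_nhds_iff,
        tendsto_pi_nhds]
      intro i
      have h2 := hw (indicatorConstLp 2 (μ := circ) (measurableSet_Ioc (a := 0) (b := t))
        (measure_ne_top _ _) (EuclideanSpace.single i 1))
      simp only [hset _ hz t ht, hset _ (hu _) t ht, EuclideanSpace.inner_single_left] at h2
      simpa using h2
    simpa [hD] using h1.sub_const (z t - z 0)
  set M : ℝ := circ.real univ ^ (1 / (2 : ENNReal).toReal)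
  -- A dominating bound, by Cauchy-Schwarz with the increment x itself as the test vector.
  have hbd : ∀ k, ∀ t ∈ Icc 0 (2 * Real.pi), ‖u k t - u k 0‖ ≤ M * C := by
    intro k t ht
    set x := u k t - u k 0
    rcases (norm_nonneg x).eq_or_lt with hx | hx
    · rw [← hx]
      exact mul_nonneg (by positivity) ((norm_nonneg _).trans (hC 0))
    have h1 := (real_inner_le_norm _ _).trans' (hset (u k) (hu k) t ht x).ge
    rw [norm_indicatorConstLp (by norm_num) (by norm_num), real_inner_self_eq_norm_sq, sq,
      mul_assoc] at h1
    refine (le_of_mul_le_mul_left h1 hx).trans ?_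
    gcongr
    · exact Real.rpow_le_rpow measureReal_nonneg
        (measureReal_mono (μ := circ) (subset_univ _) (measure_ne_top _ _)) (by norm_num)
    · exact hC k
  have hDsq : Tendsto (fun k => ∫ t, inner ℝ (D k t) (D k t) ∂circ) atTop (𝓝 0) := by
    obtain ⟨B, hB⟩ := isCompact_Icc.exists_bound_of_continuousOn
      ((hz.continuous.sub continuous_const).continuousOn (s := Icc 0 (2 * Real.pi)) (f := fun t => z t - z 0))
    have := tendsto_integral_of_dominated_convergence (μ := circ)
      (F := fun k t => inner ℝ (D k t) (D k t)) (f := fun _ => (0 : ℝ))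
      (fun _ => (M * C + B) ^ 2)
      (fun k => ((hDc k).inner (hDc k)).aestronglyMeasurable) (integrable_const _)
      (fun k => by
        filter_upwards [ae_restrict_mem measurableSet_Ioc] with t ht
        have ht' := Ioc_subset_Icc_self ht
        rw [real_inner_self_eq_norm_sq, norm_pow, norm_norm]
        refine pow_le_pow_left₀ (norm_nonneg _) ?_ 2
        exact (norm_sub_le _ _).trans (add_le_add (hbd k t ht') (hB t ht'))) (by
        filter_upwards [ae_restrict_mem measurableSet_Ioc] with t ht
        have := hpt t (Ioc_subset_Icc_self ht)
        simpa only [inner_zero_left] using this.inner (𝕜 := ℝ) this)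
    simpa using this
  have hDJ : ∀ k, MemLp (fun t => J (D k t)) 2 circ := fun k =>
    memLp_J (memLp_circ_of_continuous (hDc k))
  have hDn : Tendsto (fun k => ‖(hDJ k).toLp _‖) atTop (𝓝 0) := by
    have h1 := (Real.continuous_sqrt.tendsto 0).comp hDsq
    rw [Real.sqrt_zero] at h1
    refine h1.congr fun k => ?_
    rw [norm_eq_sqrt_real_inner, L2.inner_def, Function.comp]
    congr 1
    refine integral_congr_ae ?_
    filter_upwards [(hDJ k).coeFn_toLp] with t ht
    rw [ht, inner_J_J]
  have hzJ : MemLp (fun t => J (z t - z 0)) 2 circ :=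
    memLp_J (memLp_circ_of_continuous (hz.continuous.sub continuous_const))
  have hinner : ∀ {f g : ℝ → Phase n} (hf : MemLp f 2 circ) (hg : MemLp g 2 circ),
      inner ℝ (hf.toLp f) (hg.toLp g) = ∫ t, inner ℝ (f t) (g t) ∂circ := by
    intro f g hf hg
    rw [L2.inner_def]
    refine integral_congr_ae ?_
    filter_upwards [hf.coeFn_toLp, hg.coeFn_toLp] with t h1 h2
    rw [h1, h2]
  -- A fixed vector against a weakly convergent sequence, plus a strongly null sequence against a
  -- bounded one.
  have hsplit : ∀ k, action (u k) = 1 / 2 * (inner ℝ (hzJ.toLp _) (w k) +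
      inner ℝ ((hDJ k).toLp _) (w k)) := by
    intro k
    rw [action_eq_inner_primitive (hu k), hinner, hinner, ← integral_add
      (integrable_inner_circ hzJ (hu k).memLp_deriv)
      (integrable_inner_circ (hDJ k) (hu k).memLp_deriv)]
    congr 1
    refine integral_congr_ae (ae_of_all _ fun t => ?_)
    simp only [hD]
    rw [← inner_add_left, ← J_add, add_sub_cancel]
  have hlim : Tendsto (fun k => inner ℝ ((hDJ k).toLp _) (w k)) atTop (𝓝 0) := by
    have h1 := hDn.mul_const C
    rw [zero_mul] at h1
    refine squeeze_zero_norm (fun k => ?_) h1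
    exact (norm_inner_le_norm _ _).trans (mul_le_mul_of_nonneg_left (hC k) (norm_nonneg _))
  have := ((hw (hzJ.toLp _)).add hlim).const_mul (1 / 2)
  rw [add_zero, hinner, ← action_eq_inner_primitive hz] at this
  exact this.congr fun k => (hsplit k).symm

/-- The dual functional attains its infimum on the space of mean zero loops of action one. -/
theorem exists_minimizer (hn : 1 ≤ n) {S : Set (Phase n)} (hS : IsCompact S)
    (h0 : (0 : Phase n) ∈ interior S) :
    ∃ z ∈ loopSpace n, ∀ y ∈ loopSpace n,
      supportEnergy S (deriv z) ≤ supportEnergy S (deriv y) := by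
  have h0' := interior_subset h0
  obtain ⟨r, hr, -, hrS⟩ := exists_norm_le_supportFn hS h0
  set A := (fun y => supportEnergy S (deriv y)) '' loopSpace n with hA
  have hbdd : BddBelow A := ⟨0, by rintro _ ⟨y, -, rfl⟩; exact supportEnergy_nonneg _⟩
  obtain ⟨a, ha_anti, ha, hmem⟩ := exists_seq_tendsto_sInf ((loopSpace_nonempty hn).image _) hbdd
  choose u hu hua using hmem
  simp only at hua
  have hl : ∀ k, IsW12Loop (u k) := fun k => (hu k).1
  have hE : ∀ k, supportEnergy S ((hl k).memLp_deriv.toLp (deriv (u k))) = a k := fun k =>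
    (supportEnergy_congr (hl k).memLp_deriv.coeFn_toLp).trans (hua k)
  have hC : ∀ k, ‖(hl k).memLp_deriv.toLp (deriv (u k))‖ ≤ √((r ^ 2)⁻¹ * a 0) := by
    intro k
    rw [norm_eq_sqrt_real_inner]
    refine Real.sqrt_le_sqrt ((le_inv_mul_iff₀ (by positivity)).2 (le_trans ?_ (ha_anti (Nat.zero_le k))))
    rw [← hE, L2.inner_def, ← integral_const_mul]
    refine integral_mono ((L2.integrable_inner _ _).const_mul _)
      (integrable_supportFn_sq hS ⟨0, h0'⟩ (Lp.memLp _)) fun t => ?_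
    simp only [real_inner_self_eq_norm_sq]
    rw [← mul_pow]
    exact pow_le_pow_left₀ (by positivity) (hrS _) 2
  obtain ⟨w, φ, hφ, hw⟩ := exists_weak_limit hC
  have hw0 : ∫ t, w t ∂circ = 0 := by
    refine ext_inner_left ℝ fun c => ?_
    have h1 : ∀ v : Lp (Phase n) 2 circ, inner ℝ (indicatorConstLp 2 (μ := circ) MeasurableSet.univ
        (measure_ne_top _ _) c) v = inner ℝ c (∫ t, v t ∂circ) := fun v => by
      rw [L2.inner_indicatorConstLp_eq_inner_setIntegral, Measure.restrict_univ]
    have h2 := hw (indicatorConstLp 2 (μ := circ) MeasurableSet.univ (measure_ne_top _ _) c)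
    simp only [h1] at h2
    refine tendsto_nhds_unique h2 (tendsto_const_nhds.congr fun k => ?_)
    rw [integral_congr_ae (hl (φ k)).memLp_deriv.coeFn_toLp, (hl _).integral_deriv_circ]
  obtain ⟨z, hz, hzw, -⟩ := exists_isW12Loop_deriv_eq (Lp.memLp w) hw0
  have hzw' : hz.memLp_deriv.toLp (deriv z) = w :=
    Lp.ext (hz.memLp_deriv.coeFn_toLp.trans hzw)
  have hact : action z = 1 := by
    refine tendsto_nhds_unique (tendsto_action_of_weak (fun k => hl (φ k)) hz (fun k => hC (φ k))
      (by rw [hzw']; exact hw)) ?_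
    exact tendsto_const_nhds.congr fun k => (hu (φ k)).2.2.symm
  -- The loop z starts at 0 rather than having mean zero. The scaling factor is 1, so this only
  -- translates it.
  obtain ⟨y, hy, hyz⟩ := hz.exists_mem_loopSpace (hact ▸ one_pos)
  have hyz' : deriv y = deriv z := by funext t; rw [hyz, hact]; simp
  refine ⟨y, hy, fun y' hy' => ?_⟩
  rw [hyz', supportEnergy_congr hzw]
  refine (supportEnergy_le_of_weak_limit hS h0' hw ?_).trans (csInf_le hbdd ⟨y', hy', rfl⟩)
  simp only [hE]
  exact ha.comp hφ.tendsto_atTop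

/-! ### Smooth approximation of convex bodies -/

/-- A smooth convex function `F` with `F 0 < 1` and bounded sublevel set `{F ≤ 1}`. -/
structure IsConvexDefining (F : Phase n → ℝ) : Prop where
  contDiff : ContDiff ℝ ∞ F
  convexOn : ConvexOn ℝ univ F
  zero_lt : F 0 < 1
  isBounded : Bornology.IsBounded {x | F x ≤ 1}

section Approximation

variable {S : Set (Phase n)}

lemma mem_nhds_zero_of_interior (h0 : (0 : Phase n) ∈ interior S) : S ∈ 𝓝 (0 : Phase n) :=
  mem_interior_iff_mem_nhds.1 h0

lemma gauge_le_one_iff_mem (hS : IsConvexBody S) (h0 : (0 : Phase n) ∈ interior S) {x : Phase n} :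
    gauge S x ≤ 1 ↔ x ∈ S := by
  rw [gauge_le_one_iff_mem_closure hS.convex (mem_nhds_zero_of_interior h0),
    hS.isCompact.isClosed.closure_eq]

/-- κ⁻¹x lies outside S; a functional f with f < u on S and f(κ⁻¹x) > u is divided by κu, where u >
f(0) = 0. -/
lemma exists_separating (hS : IsConvexBody S) (h0 : (0 : Phase n) ∈ interior S) {κ : ℝ}
    (hκ : 0 < κ) {x : Phase n} (hx : κ < gauge S x) :
    ∃ f : Phase n →L[ℝ] ℝ, (∀ a ∈ S, f a ≤ κ⁻¹) ∧ 1 < f x := by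
  have hmem : κ⁻¹ • x ∉ S := fun h => by
    have h1 := (gauge_le_one_iff_mem hS h0).2 h
    rw [gauge_smul_of_nonneg (inv_nonneg.2 hκ.le), smul_eq_mul, inv_mul_le_iff₀ hκ, mul_one] at h1
    exact absurd hx (not_lt.2 h1)
  obtain ⟨f, u, hf, hu⟩ := geometric_hahn_banach_closed_point hS.convex hS.isCompact.isClosed hmem
  have hu0 : 0 < u := by simpa using hf 0 (interior_subset h0)
  refine ⟨(κ * u)⁻¹ • f, fun a ha => ?_, ?_⟩
  · have := hf a ha
    rw [_root_.smul_apply, smul_eq_mul, mul_inv, mul_assoc]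
    refine mul_le_of_le_one_right (inv_nonneg.2 hκ.le) ?_
    rw [inv_mul_le_iff₀ hu0, mul_one]
    exact this.le
  · rw [map_smul, smul_eq_mul] at hu
    rw [_root_.smul_apply, smul_eq_mul, mul_inv_rev, mul_assoc, lt_inv_mul_iff₀ hu0,
      mul_one]
    exact hu

lemma convexOn_exp_affine (f : Phase n →L[ℝ] ℝ) (β : ℝ) :
    ConvexOn ℝ univ (fun y => Real.exp (β * (f y - 1))) := by
  refine ⟨convex_univ, fun x _ y _ a b ha hb hab => ?_⟩
  have h := convexOn_exp.2 (mem_univ (β * (f x - 1))) (mem_univ (β * (f y - 1))) ha hb hab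
  convert h using 2
  simp only [map_add, map_smul, smul_eq_mul]
  obtain rfl : b = 1 - a := by linarith
  ring

/-- Every convex body around `0` lies in a body `{F ≤ 1}` contained in `(1 + ε) S`. -/
theorem exists_isConvexDefining (hS : IsConvexBody S) (h0 : (0 : Phase n) ∈ interior S) {ε : ℝ}
    (hε : 0 < ε) :
    ∃ F : Phase n → ℝ, IsConvexDefining F ∧ (∀ x ∈ S, F x ≤ 1) ∧
      ∀ x, F x ≤ 1 → (1 + ε)⁻¹ • x ∈ S := by
  classical
  have hnhds := mem_nhds_zero_of_interior h0
  have hε1 : 0 < 1 + ε := by positivity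
  have hmem : ∀ x, gauge S x ≤ 1 + ε → (1 + ε)⁻¹ • x ∈ S := fun x hx => by
    rw [← gauge_le_one_iff_mem hS h0, gauge_smul_of_nonneg (inv_nonneg.2 hε1.le), smul_eq_mul,
      inv_mul_le_iff₀ hε1, mul_one]
    exact hx
  have hbdd : Bornology.IsBounded {x : Phase n | gauge S x ≤ 1 + ε} := by
    obtain ⟨R, hR⟩ := hS.isCompact.isBounded.exists_norm_le
    refine isBounded_iff_forall_norm_le.2 ⟨(1 + ε) * R, fun x hx => ?_⟩
    have := hR _ (hmem x hx)
    rwa [norm_smul, norm_inv, Real.norm_of_nonneg hε1.le, inv_mul_le_iff₀ hε1] at this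
  set C := {x : Phase n | gauge S x = 1 + ε} with hC
  have hCc : IsCompact C := Metric.isCompact_of_isClosed_isBounded
    (isClosed_eq (continuous_gauge hS.convex hnhds) continuous_const)
    (hbdd.subset fun x hx => le_of_eq hx)
  -- A level strictly between 1 and 1 + ε leaves the gap q = 1 - κ⁻¹ between the values of each
  -- functional on S and 1.
  set κ := 1 + ε / 2 with hκ
  have hκ0 : 0 < κ := by positivity
  have hsep : ∀ x ∈ C, ∃ f : Phase n →L[ℝ] ℝ, (∀ a ∈ S, f a ≤ κ⁻¹) ∧ 1 < f x := fun x hx =>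
    exists_separating hS h0 hκ0 (by rw [hC, mem_ofPred_eq] at hx; rw [hx, hκ]; linarith)
  choose f hfS hfx using hsep
  obtain ⟨t, ht⟩ := hCc.elim_nhds_subcover' (fun x hx => {y | 1 < f x hx y})
    fun x hx => (isOpen_lt continuous_const (f x hx).continuous).mem_nhds (hfx x hx)
  set q := 1 - κ⁻¹ with hq
  have hq0 : 0 < q := sub_pos.2 (inv_lt_one_of_one_lt₀ (by rw [hκ]; linarith))
  set N : ℝ := (t.card : ℝ) with hN
  -- On S each of the N exponents is then at most -N, and N e^{-N} < 1.
  set β := N / q with hβ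
  have hβ0 : 0 ≤ β := by positivity
  set F : Phase n → ℝ := fun y => ∑ x ∈ t, Real.exp (β * (f x.1 x.2 y - 1)) with hF
  have hFS : ∀ y ∈ S, F y < 1 := fun y hy => by
    have h1 : F y ≤ ∑ x ∈ t, Real.exp (-N) := Finset.sum_le_sum fun x _ => by
      refine Real.exp_le_exp.2 ?_
      have h2 : β * q = N := div_mul_cancel₀ N hq0.ne'
      have h3 := mul_le_mul_of_nonneg_left (hfS x.1 x.2 y hy) hβ0
      rw [hq] at h2
      linarith
    refine h1.trans_lt ?_
    rw [Finset.sum_const, nsmul_eq_mul, Real.exp_neg, ← hN, mul_inv_lt_iff₀ (Real.exp_pos _)]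
    linarith [Real.add_one_le_exp N]
  -- A point beyond the level 1 + ε shrinks radially onto C, where some functional exceeds 1; it
  -- exceeds 1 at y too, so a single summand is already larger than 1.
  have hFout : ∀ y, F y ≤ 1 → gauge S y ≤ 1 + ε := fun y hy => by
    by_contra! hlt
    have hg0 : 0 < gauge S y := hε1.trans hlt
    have hs0 : 0 < (1 + ε) / gauge S y := by positivity
    have hs1 : (1 + ε) / gauge S y ≤ 1 := (div_le_one hg0).2 hlt.le
    have hyC : ((1 + ε) / gauge S y) • y ∈ C := by
      rw [hC, mem_ofPred_eq, gauge_smul_of_nonneg hs0.le, smul_eq_mul, div_mul_cancel₀ _ hg0.ne']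
    obtain ⟨x, hx⟩ := mem_iUnion.1 (ht hyC)
    obtain ⟨hxt, hx⟩ := mem_iUnion.1 hx
    rw [mem_ofPred_eq, map_smul, smul_eq_mul] at hx
    have h1 : 1 < f x.1 x.2 y := by
      by_contra! hle
      nlinarith
    have h2 : Real.exp (β * (f x.1 x.2 y - 1)) ≤ F y :=
      Finset.single_le_sum (f := fun x : C => Real.exp (β * (f x.1 x.2 y - 1)))
        (fun _ _ => (Real.exp_pos _).le) hxt
    have hN1 : 0 < N := by
      rw [hN]; exact_mod_cast Finset.card_pos.2 ⟨x, hxt⟩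
    have h3 : 1 < Real.exp (β * (f x.1 x.2 y - 1)) :=
      Real.one_lt_exp_iff.2 (mul_pos (div_pos hN1 hq0) (by linarith))
    linarith
  refine ⟨F, ⟨?_, ?_, hFS 0 (interior_subset h0), hbdd.subset fun x hx => hFout x hx⟩,
    fun x hx => (hFS x hx).le, fun x hx => hmem x (hFout x hx)⟩
  · exact ContDiff.sum fun x _ => (contDiff_const.mul ((f x.1 x.2).contDiff.sub contDiff_const)).exp
  · refine ⟨convex_univ, fun x hx y hy a b ha hb hab => ?_⟩
    simp only [hF, Finset.smul_sum, ← Finset.sum_add_distrib]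
    exact Finset.sum_le_sum fun i _ => (convexOn_exp_affine (f i.1 i.2) β).2 hx hy ha hb hab

end Approximation

/-! ### The body `{F ≤ 1}` -/

namespace IsConvexDefining

variable {F : Phase n → ℝ} (hF : IsConvexDefining F)

/-- The body bounded by the level set `{F = 1}`. -/
abbrev _root_.EHZ.body (F : Phase n → ℝ) : Set (Phase n) := {x | F x ≤ 1}

/-- The outer normal of the level set of `F`, scaled to have inner product one with the base
point. -/
def _root_.EHZ.normal (F : Phase n → ℝ) (x : Phase n) : Phase n :=
  (inner ℝ (gradient F x) x)⁻¹ • gradient F x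

lemma inner_gradient (x v : Phase n) : inner ℝ (gradient F x) v = fderiv ℝ F x v := by
  rw [gradient, InnerProductSpace.toDual_symm_apply]

include hF

lemma differentiable : Differentiable ℝ F := hF.contDiff.differentiable (by simp)

/-- By convexity, the difference quotients from x towards y are at most F y - F x. -/
lemma add_inner_gradient_le (x y : Phase n) : F x + inner ℝ (gradient F x) (y - x) ≤ F y := by
  rw [inner_gradient]
  have h1 : HasDerivAt (fun t : ℝ => F (x + t • (y - x))) (fderiv ℝ F x (y - x)) 0 :=
    (hF.differentiable x).hasFDerivAt.hasLineDerivAt (y - x)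
  have h2 := h1.hasDerivWithinAt (s := Ioi 0)
  rw [hasDerivWithinAt_iff_tendsto_slope' (by simp)] at h2
  have h3 : ∀ᶠ t in 𝓝[>] (0 : ℝ), slope (fun t : ℝ => F (x + t • (y - x))) 0 t ≤ F y - F x := by
    filter_upwards [Ioo_mem_nhdsGT (zero_lt_one' ℝ)] with t ht
    have h4 := hF.convexOn.2 (mem_univ x) (mem_univ y) (sub_nonneg.2 ht.2.le) ht.1.le (by ring)
    rw [show (1 - t) • x + t • y = x + t • (y - x) by module, smul_eq_mul, smul_eq_mul] at h4
    rw [slope_def_field, zero_smul, add_zero, sub_zero, div_le_iff₀ ht.1]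
    linarith
  linarith [le_of_tendsto h2 h3]

lemma inner_gradient_pos {x : Phase n} (hx : F x = 1) : 0 < inner ℝ (gradient F x) x := by
  have h1 := hF.add_inner_gradient_le x 0
  rw [zero_sub, inner_neg_right, hx] at h1
  linarith [hF.zero_lt]

lemma isClosed_body : IsClosed (body F) := isClosed_le hF.contDiff.continuous continuous_const

lemma isCompact_body : IsCompact (body F) :=
  Metric.isCompact_of_isClosed_isBounded hF.isClosed_body hF.isBounded

lemma zero_mem_interior : (0 : Phase n) ∈ interior (body F) :=
  mem_interior.2 ⟨{x | F x < 1}, fun x (hx : F x < 1) => hx.le,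
    isOpen_lt hF.contDiff.continuous continuous_const, hF.zero_lt⟩

lemma isConvexBody : IsConvexBody (body F) where
  convex := by simpa using hF.convexOn.convex_le 1
  isCompact := hF.isCompact_body
  nonempty_interior := ⟨0, hF.zero_mem_interior⟩

lemma mem_frontier_iff {x : Phase n} : x ∈ frontier (body F) ↔ F x = 1 := by
  constructor
  · exact fun h => frontier_le_subset_eq hF.contDiff.continuous continuous_const h
  · intro h
    refine ⟨subset_closure h.le, fun hint => ?_⟩
    -- Pushing x radially outwards would stay in the body, but F increases strictly in that
    -- direction.
    have h1 : ∀ᶠ t in 𝓝[>] (1 : ℝ), F (t • x) ≤ 1 := by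
      have h2 : Tendsto (fun t : ℝ => t • x) (𝓝 1) (𝓝 x) := by
        have : Continuous fun t : ℝ => t • x := by fun_prop
        simpa using this.tendsto 1
      exact (h2.eventually (mem_interior_iff_mem_nhds.1 hint)).filter_mono nhdsWithin_le_nhds
    obtain ⟨t, ht, ht1⟩ := (h1.and self_mem_nhdsWithin).exists
    have h3 := hF.add_inner_gradient_le x (t • x)
    rw [show t • x - x = (t - 1) • x by module, inner_smul_right, h] at h3
    have := mul_pos (sub_pos.2 (mem_Ioi.1 ht1)) (hF.inner_gradient_pos h)
    linarith

lemma fderiv_ne_zero {x : Phase n} (hx : F x = 1) : fderiv ℝ F x ≠ 0 := by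
  intro h
  have := hF.inner_gradient_pos hx
  rw [inner_gradient, h] at this
  simp at this

lemma hasSmoothBoundary : HasSmoothBoundary (body F) := by
  intro x hx
  refine ⟨univ, fun y => F y - 1, isOpen_univ, mem_univ x,
    (hF.contDiff.sub contDiff_const).contDiffOn, ?_, ?_⟩
  · rw [fderiv_sub_const]
    exact hF.fderiv_ne_zero (hF.mem_frontier_iff.1 hx)
  · ext y; simp

lemma contDiff_gradient : ContDiff ℝ ∞ (gradient F) :=
  (InnerProductSpace.toDual ℝ (Phase n)).symm.contDiff.comp (hF.contDiff.fderiv_right (by simp))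

lemma contDiffAt_normal {x : Phase n} (hx : F x = 1) : ContDiffAt ℝ ∞ (normal F) x :=
  ((hF.contDiff_gradient.inner ℝ contDiff_id).contDiffAt.inv
    (hF.inner_gradient_pos hx).ne').smul hF.contDiff_gradient.contDiffAt

lemma inner_normal_self {x : Phase n} (hx : F x = 1) : inner ℝ (normal F x) x = 1 := by
  rw [normal, real_inner_smul_left, inv_mul_cancel₀ (hF.inner_gradient_pos hx).ne']

lemma inner_normal_le {x y : Phase n} (hx : F x = 1) (hy : F y ≤ 1) :
    inner ℝ (normal F x) y ≤ 1 := by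
  have h := hF.add_inner_gradient_le x y
  rw [inner_sub_right] at h
  rw [normal, real_inner_smul_left, inv_mul_le_iff₀ (hF.inner_gradient_pos hx)]
  linarith

/-! ### The quadratic Hamiltonian of the body -/

lemma gauge_pos {x : Phase n} (hx : x ≠ 0) : 0 < gauge (body F) x :=
  (_root_.gauge_pos (absorbent_nhds_zero (mem_nhds_zero_of_interior hF.zero_mem_interior))
    (NormedSpace.isVonNBounded_of_isBounded ℝ hF.isBounded)).2 hx

lemma continuous_gauge : Continuous (gauge (body F)) :=
  _root_.continuous_gauge hF.isConvexBody.convex (mem_nhds_zero_of_interior hF.zero_mem_interior)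

lemma gauge_eq_one_iff {x : Phase n} : gauge (body F) x = 1 ↔ F x = 1 := by
  rw [gauge_eq_one_iff_mem_frontier hF.isConvexBody.convex
    (mem_nhds_zero_of_interior hF.zero_mem_interior), hF.mem_frontier_iff]

lemma apply_inv_gauge_smul {x : Phase n} (hx : x ≠ 0) : F ((gauge (body F) x)⁻¹ • x) = 1 := by
  have h := hF.gauge_pos hx
  rw [← hF.gauge_eq_one_iff, gauge_smul_of_nonneg (inv_nonneg.2 h.le), smul_eq_mul,
    inv_mul_cancel₀ h.ne']

lemma inner_normal_le_gauge {x : Phase n} (hx : F x = 1) (y : Phase n) :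
    inner ℝ (normal F x) y ≤ gauge (body F) y := by
  rcases eq_or_ne y 0 with rfl | hy
  · simp
  have h := hF.inner_normal_le hx (hF.apply_inv_gauge_smul hy).le
  rwa [real_inner_smul_right, inv_mul_le_iff₀ (hF.gauge_pos hy), mul_one] at h

lemma inner_le_supportFn_mul_gauge (u x : Phase n) :
    inner ℝ u x ≤ supportFn (body F) u * gauge (body F) x := by
  rcases eq_or_ne x 0 with rfl | hx
  · simp
  have h := inner_le_supportFn hF.isCompact_body (hF.apply_inv_gauge_smul hx).le u
  rwa [real_inner_smul_left, inv_mul_le_iff₀ (hF.gauge_pos hx), mul_comm, real_inner_comm] at h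

/-- The gradient of the Hamiltonian `g² / 2`, where `g` is the gauge of `{F ≤ 1}`. -/
def _root_.EHZ.hamGrad (F : Phase n → ℝ) (x : Phase n) : Phase n :=
  gauge (body F) x • normal F ((gauge (body F) x)⁻¹ • x)

lemma inner_hamGrad_self (x : Phase n) : inner ℝ (hamGrad F x) x = gauge (body F) x ^ 2 := by
  rcases eq_or_ne x 0 with rfl | hx
  · simp
  have h := hF.inner_normal_self (hF.apply_inv_gauge_smul hx)
  have hg := hF.gauge_pos hx
  rw [real_inner_smul_right, inv_mul_eq_one₀ hg.ne'] at h
  rw [hamGrad, real_inner_smul_left, ← h, sq]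

lemma inner_hamGrad_le (x y : Phase n) :
    inner ℝ (hamGrad F x) y ≤ gauge (body F) x * gauge (body F) y := by
  rcases eq_or_ne x 0 with rfl | hx
  · simp [hamGrad]
  rw [hamGrad, real_inner_smul_left]
  exact mul_le_mul_of_nonneg_left
    (hF.inner_normal_le_gauge (hF.apply_inv_gauge_smul hx) y) (gauge_nonneg x)

lemma supportFn_hamGrad_le (x : Phase n) : supportFn (body F) (hamGrad F x) ≤ gauge (body F) x := by
  refine supportFn_le ⟨0, hF.zero_lt.le⟩ fun y hy => ?_
  rw [real_inner_comm]
  refine (hF.inner_hamGrad_le x y).trans (mul_le_of_le_one_right (gauge_nonneg x) ?_)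
  exact gauge_le_one_of_mem hy

/-- From ⟨V x, x⟩ = g(x)², ⟨V x, y⟩ ≤ g(x)g(y) and 2g(x)g(y) ≤ g(x)² + g(y)², with V = `hamGrad F`.
This makes V x a subgradient of g²/2 before any differentiability is known. -/
lemma ham_add_inner_le (x y : Phase n) :
    gauge (body F) x ^ 2 / 2 + inner ℝ (hamGrad F x) (y - x) ≤ gauge (body F) y ^ 2 / 2 := by
  rw [inner_sub_right, hF.inner_hamGrad_self]
  nlinarith [hF.inner_hamGrad_le x y, sq_nonneg (gauge (body F) x - gauge (body F) y)]

lemma continuous_hamGrad : Continuous (hamGrad F) := by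
  obtain ⟨r, hr, -, hrS⟩ := exists_norm_le_supportFn hF.isCompact_body hF.zero_mem_interior
  refine continuous_iff_continuousAt.2 fun x => ?_
  rcases eq_or_ne x 0 with rfl | hx
  · have h0 : hamGrad F 0 = 0 := by simp [hamGrad]
    rw [ContinuousAt, h0]
    have h1 : Tendsto (fun y => r⁻¹ * gauge (body F) y) (𝓝 0) (𝓝 0) := by
      have := (hF.continuous_gauge.tendsto 0).const_mul r⁻¹
      simpa using this
    refine squeeze_zero_norm (fun y => ?_) h1
    rw [le_inv_mul_iff₀ hr]
    exact (hrS _).trans (hF.supportFn_hamGrad_le y)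
  · have hg := hF.continuous_gauge.continuousAt (x := x)
    refine hg.smul (ContinuousAt.comp (g := normal F) ?_
      ((hg.inv₀ (hF.gauge_pos hx).ne').smul continuousAt_id))
    exact (hF.contDiffAt_normal (hF.apply_inv_gauge_smul hx)).continuousAt

/-- Equality in the Fenchel-Young inequality. -/
lemma eq_hamGrad_of_fenchel_eq {u x : Phase n}
    (h : supportFn (body F) u ^ 2 / 2 + gauge (body F) x ^ 2 / 2 ≤ inner ℝ u x) :
    u = hamGrad F x := by
  set d := u - hamGrad F x with hd
  -- Minty's argument: equality makes u a subgradient at x; compare it with the subgradient at x +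
  -- sd and let s → 0.
  have h1 : ∀ s : ℝ, 0 < s → inner ℝ (u - hamGrad F (x + s • d)) d ≤ 0 := by
    intro s hs
    have h2 := hF.inner_le_supportFn_mul_gauge u (x + s • d)
    have h3 := hF.ham_add_inner_le (x + s • d) x
    rw [show x - (x + s • d) = -(s • d) by abel, inner_neg_right, inner_smul_right] at h3
    rw [inner_add_right, inner_smul_right] at h2
    rw [inner_sub_left]
    have h4 : s * (inner ℝ u d - inner ℝ (hamGrad F (x + s • d)) d) ≤ 0 := by
      nlinarith [sq_nonneg (supportFn (body F) u - gauge (body F) (x + s • d))]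
    exact nonpos_of_mul_nonpos_right h4 hs
  have h2 : Tendsto (fun s : ℝ => inner ℝ (u - hamGrad F (x + s • d)) d) (𝓝[>] 0)
      (𝓝 (inner ℝ (u - hamGrad F x) d)) := by
    have hc : Continuous fun s : ℝ => inner ℝ (u - hamGrad F (x + s • d)) d := by
      have := hF.continuous_hamGrad
      fun_prop
    have := (hc.tendsto 0).mono_left (nhdsWithin_le_nhds (s := Ioi 0))
    simpa using this
  have h3 : inner ℝ d d ≤ 0 := le_of_tendsto h2 (by
    filter_upwards [self_mem_nhdsWithin] with s hs
    exact h1 s hs)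
  exact sub_eq_zero.1 (real_inner_self_nonpos.1 h3)

/-- The subgradient inequalities at both points put the first-order remainder between 0 and ⟨V y - V
x, y - x⟩, which is o(‖y - x‖) by continuity of V = `hamGrad F`. -/
lemma hasDerivAt_ham {ψ : ℝ → Phase n} {ψ' : Phase n} {t : ℝ} (h : HasDerivAt ψ ψ' t) :
    HasDerivAt (fun s => gauge (body F) (ψ s) ^ 2 / 2) (inner ℝ (hamGrad F (ψ t)) ψ') t := by
  have h1 : HasGradientAt (fun x => gauge (body F) x ^ 2 / 2) (hamGrad F (ψ t)) (ψ t) := by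
    rw [hasGradientAt_iff_isLittleO, Asymptotics.isLittleO_iff]
    intro c hc
    have h2 : ∀ᶠ y in 𝓝 (ψ t), ‖hamGrad F y - hamGrad F (ψ t)‖ < c := by
      have := hF.continuous_hamGrad.continuousAt (x := ψ t)
      simpa [dist_eq_norm] using this.eventually (Metric.ball_mem_nhds _ hc)
    filter_upwards [h2] with y hy
    have h3 := hF.ham_add_inner_le (ψ t) y
    have h4 := hF.ham_add_inner_le y (ψ t)
    rw [← neg_sub y (ψ t), inner_neg_right] at h4
    have h5 := real_inner_le_norm (hamGrad F y - hamGrad F (ψ t)) (y - ψ t)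
    rw [inner_sub_left] at h5
    have h6 : ‖hamGrad F y - hamGrad F (ψ t)‖ * ‖y - ψ t‖ ≤ c * ‖y - ψ t‖ := by gcongr
    rw [Real.norm_eq_abs, abs_le]
    constructor <;> nlinarith
  refine (h1.hasFDerivAt.comp_hasDerivAt t h).congr_deriv ?_
  rw [InnerProductSpace.toDual_apply_apply]

end IsConvexDefining

/-! ### The Euler-Lagrange equation -/

section Minimizer

variable {S : Set (Phase n)} {z : ℝ → Phase n}

/-- Energy and action are both homogeneous of degree two, so the constraint can be traded for an
inequality on all loops. Variations may then leave the constraint set. -/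
lemma mul_action_le_of_minimizer
    (hmin : ∀ y ∈ loopSpace n, supportEnergy S (deriv z) ≤ supportEnergy S (deriv y))
    {y : ℝ → Phase n} (hy : IsW12Loop y) :
    supportEnergy S (deriv z) * action y ≤ supportEnergy S (deriv y) := by
  rcases le_or_gt (action y) 0 with h | h
  · exact (mul_nonpos_of_nonneg_of_nonpos (supportEnergy_nonneg _) h).trans (supportEnergy_nonneg _)
  · obtain ⟨u, hu, hd⟩ := hy.exists_mem_loopSpace h
    have h1 := hmin u hu
    rw [funext hd, supportEnergy_smul (by positivity), inv_pow, Real.sq_sqrt h.le,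
      le_inv_mul_iff₀ h] at h1
    linarith

lemma supportEnergy_pos (hS : IsCompact S) (h0 : (0 : Phase n) ∈ interior S) (hz : IsW12Loop z)
    (ha : action z = 1) : 0 < supportEnergy S (deriv z) := by
  refine (supportEnergy_nonneg _).lt_of_ne' fun h => ?_
  obtain ⟨r, hr, -, hrS⟩ := exists_norm_le_supportFn hS h0
  rw [supportEnergy, integral_eq_zero_iff_of_nonneg (fun _ => sq_nonneg _)
    (integrable_supportFn_sq hS ⟨0, interior_subset h0⟩ hz.memLp_deriv)] at h
  have h1 : ∫ t, inner ℝ (J (z t)) (deriv z t) ∂circ = 0 := by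
    refine integral_eq_zero_of_ae ?_
    filter_upwards [h] with t ht
    have h2 := hrS (deriv z t)
    rw [pow_eq_zero_iff two_ne_zero |>.1 ht] at h2
    have h3 : deriv z t = 0 := norm_le_zero_iff.1 (by nlinarith [norm_nonneg (deriv z t)])
    rw [h3, inner_zero_right]; rfl
  rw [action_eq, h1] at ha
  norm_num at ha

end Minimizer

namespace IsConvexDefining

variable {F : Phase n → ℝ} (hF : IsConvexDefining F)

include hF

lemma exists_norm_le_mul_gauge : ∃ R, 0 < R ∧ ∀ x, ‖x‖ ≤ R * gauge (body F) x := by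
  obtain ⟨R, hR, -, h⟩ := exists_supportFn_le_norm hF.isCompact_body ⟨0, hF.zero_lt.le⟩
  refine ⟨R, hR, fun x => ?_⟩
  have h1 := hF.inner_le_supportFn_mul_gauge x x
  rw [real_inner_self_eq_norm_sq] at h1
  rcases (norm_nonneg x).eq_or_lt with hx | hx
  · rw [← hx]; exact mul_nonneg hR.le (gauge_nonneg x)
  · have h2 := mul_le_mul_of_nonneg_right (h x) (gauge_nonneg (s := body F) x)
    refine le_of_mul_le_mul_left ?_ hx
    nlinarith

/-- Every continuous curve has a translate along which the gradient of the Hamiltonian has mean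
zero. -/
lemma exists_translate_integral_hamGrad_eq_zero {ψ : ℝ → Phase n} (hψ : Continuous ψ) :
    ∃ c, ∫ t, hamGrad F (ψ t + c) ∂circ = 0 := by
  have hg := hF.continuous_gauge
  have hV := hF.continuous_hamGrad
  -- A minimizer of this coercive function is the required translate, as its formal gradient is the
  -- integral in question.
  set K : Phase n → ℝ := fun c => ∫ t, gauge (body F) (ψ t + c) ^ 2 / 2 ∂circ with hK
  have hKi : ∀ c, Integrable (fun t => gauge (body F) (ψ t + c) ^ 2 / 2) circ := fun c =>
    integrable_circ_of_continuous (by fun_prop)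
  have hKc : Continuous K := by
    simp only [hK, ← integral_circ]
    exact intervalIntegral.continuous_parametric_intervalIntegral_of_continuous' (by fun_prop) _ _
  obtain ⟨R, hR, hRg⟩ := hF.exists_norm_le_mul_gauge
  obtain ⟨M, hM⟩ := isCompact_Icc.exists_bound_of_continuousOn
    (hψ.continuousOn (s := Icc 0 (2 * Real.pi)))
  have hlow : ∀ c, 2 * Real.pi * (R⁻¹ * (‖c‖ - M) - 1 / 2) ≤ K c := fun c => by
    have h1 : ∫ _, (R⁻¹ * (‖c‖ - M) - 1 / 2) ∂circ ≤ K c := by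
      refine integral_mono_ae (integrable_const _) (hKi c) ?_
      filter_upwards [ae_restrict_mem measurableSet_Ioc] with t ht
      have h2 := hM t (Ioc_subset_Icc_self ht)
      have h3 := hRg (ψ t + c)
      have h4 : ‖c‖ ≤ ‖ψ t + c‖ + ‖ψ t‖ := by
        simpa using norm_sub_le (ψ t + c) (ψ t)
      have h5 : R⁻¹ * (‖c‖ - M) ≤ gauge (body F) (ψ t + c) := by
        rw [inv_mul_le_iff₀ hR]; linarith
      nlinarith [sq_nonneg (gauge (body F) (ψ t + c) - 1)]
    rw [integral_const, measureReal_restrict_apply_univ, Real.volume_real_Ioc,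
      max_eq_left (by linarith [Real.two_pi_pos]), sub_zero, smul_eq_mul] at h1
    exact h1
  have hlim : Tendsto K (cocompact _) atTop := by
    refine tendsto_atTop_mono hlow (Tendsto.const_mul_atTop Real.two_pi_pos ?_)
    refine tendsto_atTop_add_const_right _ _ (Tendsto.const_mul_atTop (inv_pos.2 hR) ?_)
    exact tendsto_atTop_add_const_right _ _ tendsto_norm_cocompact_atTop
  obtain ⟨c, hc⟩ := hKc.exists_forall_le hlim
  refine ⟨c, ?_⟩
  have hVi : ∀ c, Integrable (fun t => hamGrad F (ψ t + c)) circ := fun c =>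
    integrable_circ_of_continuous (by fun_prop)
  have hpos : ∀ d, 0 ≤ inner ℝ d (∫ t, hamGrad F (ψ t + c) ∂circ) := by
    intro d
    -- The subgradient inequality at the displaced point replaces differentiation under the integral
    -- sign.
    have h1 : ∀ s : ℝ, 0 < s → 0 ≤ ∫ t, inner ℝ d (hamGrad F (ψ t + (c + s • d))) ∂circ := by
      intro s hs
      have h2 := hc (c + s • d)
      rw [← sub_nonneg, hK, ← integral_sub (hKi _) (hKi _)] at h2
      have h3 : 0 ≤ ∫ t, s * inner ℝ d (hamGrad F (ψ t + (c + s • d))) ∂circ := by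
        refine h2.trans (integral_mono ((hKi _).sub (hKi _)) (((hVi _).const_inner d).const_mul s)
          fun t => ?_)
        have h4 := hF.ham_add_inner_le (ψ t + (c + s • d)) (ψ t + c)
        rw [show ψ t + c - (ψ t + (c + s • d)) = -(s • d) by abel, inner_neg_right,
          real_inner_smul_right, real_inner_comm] at h4
        simp only
        linarith
      rw [integral_const_mul] at h3
      exact nonneg_of_mul_nonneg_right h3 hs
    have h2 : Tendsto (fun s : ℝ => ∫ t, inner ℝ d (hamGrad F (ψ t + (c + s • d))) ∂circ) (𝓝[>] 0)
        (𝓝 (∫ t, inner ℝ d (hamGrad F (ψ t + c)) ∂circ)) := by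
      have h3 : Continuous fun s : ℝ => ∫ t, inner ℝ d (hamGrad F (ψ t + (c + s • d))) ∂circ := by
        simp only [← integral_circ]
        exact intervalIntegral.continuous_parametric_intervalIntegral_of_continuous'
          (by fun_prop) _ _
      have := (h3.tendsto 0).mono_left (nhdsWithin_le_nhds (s := Ioi 0))
      simpa using this
    rw [← integral_inner (hVi c)]
    exact ge_of_tendsto h2 (by filter_upwards [self_mem_nhdsWithin] with s hs using h1 s hs)
  have h1 := hpos (-∫ t, hamGrad F (ψ t + c) ∂circ)
  rw [inner_neg_left, neg_nonneg] at h1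
  exact real_inner_self_nonpos.1 h1

/-- A minimizer of the dual functional solves the Hamiltonian system of the gauge. -/
lemma exists_deriv_eq_hamGrad {z : ℝ → Phase n} (hz : z ∈ loopSpace n)
    (hmin : ∀ y ∈ loopSpace n,
      supportEnergy (body F) (deriv z) ≤ supportEnergy (body F) (deriv y)) {m : ℝ}
    (hm : 2 * m = supportEnergy (body F) (deriv z)) :
    ∃ c, (∀ᵐ t ∂circ, deriv z t = hamGrad F (m • J (z t) + c)) ∧
      ∫ t, gauge (body F) (m • J (z t) + c) ^ 2 ∂circ = 2 * m := by
  have hzl := hz.1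
  have hg := hF.continuous_gauge
  have hV := hF.continuous_hamGrad
  have hzc := hzl.continuous
  obtain ⟨c, hc⟩ := hF.exists_translate_integral_hamGrad_eq_zero
    (ψ := fun t => m • J (z t)) (by fun_prop)
  set ψ : ℝ → Phase n := fun t => m • J (z t) + c with hψ
  have hψc : Continuous ψ := by fun_prop
  have hact : ∫ t, inner ℝ (J (z t)) (deriv z t) ∂circ = 2 := by
    have := hz.2.2
    rw [action_eq] at this
    linarith
  -- The decisive variation has y' = ∇H(ψ), where H = g²/2; the choice of c makes this the
  -- derivative of a loop.
  obtain ⟨y, hyl, hyd, -⟩ := exists_isW12Loop_deriv_eq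
    (memLp_circ_of_continuous (hV.comp hψc)) hc
  have hb : m * ∫ t, inner ℝ (J (z t)) (deriv y t) ∂circ = ∫ t, gauge (body F) (ψ t) ^ 2 ∂circ := by
    have h1 : ∀ t, gauge (body F) (ψ t) ^ 2 =
        m * inner ℝ (J (z t)) (hamGrad F (ψ t)) + inner ℝ c (hamGrad F (ψ t)) := fun t => by
      rw [← hF.inner_hamGrad_self, real_inner_comm, ← real_inner_smul_left, ← inner_add_left]
    have i1 : Integrable (fun t => inner ℝ c (hamGrad F (ψ t))) circ :=
      integrable_circ_of_continuous (by fun_prop)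
    have i2 : Integrable (fun t => m * inner ℝ (J (z t)) (hamGrad F (ψ t))) circ :=
      integrable_circ_of_continuous (by fun_prop)
    simp only [h1]
    rw [integral_add i2 i1, integral_inner (integrable_circ_of_continuous (by fun_prop)), hc,
      inner_zero_right, add_zero, integral_const_mul]
    congr 1
    refine integral_congr_ae ?_
    filter_upwards [hyd] with t ht
    rw [ht]; rfl
  set h₀ := ∫ t, gauge (body F) (ψ t) ^ 2 ∂circ with hh₀
  have ig : Integrable (fun t => gauge (body F) (ψ t) ^ 2) circ :=
    integrable_circ_of_continuous (by fun_prop)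
  have hh2 : Integrable (fun t => supportFn (body F) (deriv z t) ^ 2) circ :=
    integrable_supportFn_sq hF.isCompact_body ⟨0, hF.zero_lt.le⟩ hzl.memLp_deriv
  have hgm : MemLp (fun t => gauge (body F) (ψ t)) 2 circ :=
    (memLp_two_iff_integrable_sq (hg.comp hψc).aestronglyMeasurable).2 ig
  have ihg : Integrable (fun t => supportFn (body F) (deriv z t) * gauge (body F) (ψ t)) circ :=
    (memLp_supportFn hF.isCompact_body ⟨0, hF.zero_lt.le⟩ hzl.memLp_deriv).integrable_mul hgm
  set p := ∫ t, supportFn (body F) (deriv z t) * gauge (body F) (ψ t) ∂circ with hp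
  have hE : ∫ t, supportFn (body F) (deriv z t) ^ 2 ∂circ = 2 * m := hm.symm
  -- Compare z + sy with the minimum: the action term contributes 2s·h₀ to first order, the energy
  -- at most 2s·p, because h(∇H(ψ)) ≤ g(ψ).
  have hvar : ∀ s : ℝ, 0 < s → 2 * h₀ - p ≤ p + s * (h₀ - 2 * m * action y) := by
    intro s hs
    have h1 := mul_action_le_of_minimizer hmin (hzl.add_smul hyl s).1
    rw [hzl.action_add_smul hyl, hz.2.2, ← hm] at h1
    have h2 : supportEnergy (body F) (deriv fun t => z t + s • y t) ≤
        2 * m + 2 * s * p + s ^ 2 * h₀ := by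
      rw [hp, hh₀, ← hE, ← integral_const_mul, ← integral_const_mul,
        ← integral_add hh2 (ihg.const_mul _), ← integral_add (hh2.fun_add (ihg.const_mul _))
        (ig.const_mul _)]
      refine integral_mono_ae (integrable_supportFn_sq hF.isCompact_body ⟨0, hF.zero_lt.le⟩
        (hzl.add_smul hyl s).1.memLp_deriv) ((hh2.fun_add (ihg.const_mul _)).fun_add (ig.const_mul _)) ?_
      filter_upwards [(hzl.add_smul hyl s).2, hyd] with t h3 h4
      rw [h3, h4]
      have h5 := supportFn_add_le hF.isCompact_body ⟨0, hF.zero_lt.le⟩ (deriv z t)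
        (s • hamGrad F (ψ t))
      rw [supportFn_smul hs.le] at h5
      have h6 := mul_le_mul_of_nonneg_left (hF.supportFn_hamGrad_le (ψ t)) hs.le
      have h7 := pow_le_pow_left₀ (supportFn_nonneg hF.isCompact_body hF.zero_lt.le _)
        (h5.trans (add_le_add_right h6 _)) 2
      simp only [Function.comp_apply] at h7 ⊢
      nlinarith
    have h3 := h1.trans h2
    have h4 : s * (2 * h₀ - p) ≤ s * (p + s * (h₀ - 2 * m * action y)) := by
      rw [← hb]
      rw [← hb] at h3
      nlinarith
    exact le_of_mul_le_mul_left h4 hs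
  have hp1 : h₀ ≤ p := by
    have h1 : Tendsto (fun s : ℝ => p + s * (h₀ - 2 * m * action y)) (𝓝[>] 0) (𝓝 p) := by
      have : Continuous fun s : ℝ => p + s * (h₀ - 2 * m * action y) := by fun_prop
      simpa using (this.tendsto 0).mono_left (nhdsWithin_le_nhds (s := Ioi 0))
    have h2 := ge_of_tendsto h1 (by
      filter_upwards [self_mem_nhdsWithin] with s hs using hvar s hs)
    linarith
  have hp2 : p ≤ m + h₀ / 2 := by
    have h1 : p ≤ ∫ t, (1 / 2 * supportFn (body F) (deriv z t) ^ 2 +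
        1 / 2 * gauge (body F) (ψ t) ^ 2) ∂circ := by
      refine integral_mono ihg ((hh2.const_mul _).add (ig.const_mul _)) fun t => ?_
      nlinarith [sq_nonneg (supportFn (body F) (deriv z t) - gauge (body F) (ψ t))]
    rw [integral_add (hh2.const_mul _) (ig.const_mul _), integral_const_mul, integral_const_mul,
      hE] at h1
    linarith
  have iin : Integrable (fun t => inner ℝ (deriv z t) (ψ t)) circ :=
    integrable_inner_circ hzl.memLp_deriv (memLp_circ_of_continuous hψc)
  have hin : ∫ t, inner ℝ (deriv z t) (ψ t) ∂circ = 2 * m := by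
    have h1 : ∀ t, inner ℝ (deriv z t) (ψ t) =
        m * inner ℝ (J (z t)) (deriv z t) + inner ℝ c (deriv z t) := fun t => by
      rw [real_inner_comm, ← real_inner_smul_left, ← inner_add_left]
    simp only [h1]
    rw [integral_add ((hzl.integrable_action hzl).const_mul m) (hzl.integrable_deriv.const_inner c),
      integral_const_mul, hact, integral_inner hzl.integrable_deriv, hzl.integral_deriv_circ,
      inner_zero_right]
    ring
  have hnn : ∀ t, 0 ≤ supportFn (body F) (deriv z t) ^ 2 / 2 + gauge (body F) (ψ t) ^ 2 / 2 -
      inner ℝ (deriv z t) (ψ t) := fun t => by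
    have h1 := hF.inner_le_supportFn_mul_gauge (deriv z t) (ψ t)
    nlinarith [sq_nonneg (supportFn (body F) (deriv z t) - gauge (body F) (ψ t))]
  have itot : Integrable (fun t => supportFn (body F) (deriv z t) ^ 2 / 2 +
      gauge (body F) (ψ t) ^ 2 / 2 - inner ℝ (deriv z t) (ψ t)) circ :=
    ((hh2.div_const 2).add (ig.div_const 2)).sub iin
  have htot : ∫ t, (supportFn (body F) (deriv z t) ^ 2 / 2 + gauge (body F) (ψ t) ^ 2 / 2 -
      inner ℝ (deriv z t) (ψ t)) ∂circ = h₀ / 2 - m := by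
    rw [integral_sub ((hh2.div_const 2).fun_add (ig.div_const 2)) iin,
      integral_add (hh2.div_const 2) (ig.div_const 2), integral_div, integral_div, hE, hin]
    ring
  -- h₀ ≤ p ≤ m + h₀/2 gives h₀ ≤ 2m, while the integrated Fenchel-Young defect h₀/2 - m is
  -- nonnegative. So the defect vanishes almost everywhere.
  have h0 : h₀ / 2 - m = 0 :=
    le_antisymm (by linarith) (htot ▸ integral_nonneg hnn)
  refine ⟨c, ?_, by linarith⟩
  rw [h0, integral_eq_zero_iff_of_nonneg hnn itot] at htot
  filter_upwards [htot] with t ht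
  exact hF.eq_hamGrad_of_fenchel_eq (sub_nonpos.1 ht.le)

end IsConvexDefining

/-! ### Autonomous differential equations -/

/-- Two solutions of an autonomous equation with the same initial value agree. -/
lemma eq_of_autonomous_ode {E : Type*} [NormedAddCommGroup E] [NormedSpace ℝ E] {v : E → E}
    {x y : ℝ → E} (hv : ∀ t, ContDiffAt ℝ 1 v (x t)) (hx : ∀ t, HasDerivAt x (v (x t)) t)
    (hy : ∀ t, HasDerivAt y (v (y t)) t) {t₀ : ℝ} (h : x t₀ = y t₀) : x = y := by
  have hxc : Continuous x := continuous_iff_continuousAt.2 fun t => (hx t).continuousAt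
  have hyc : Continuous y := continuous_iff_continuousAt.2 fun t => (hy t).continuousAt
  have hclopen : IsClopen {t | x t = y t} := by
    refine ⟨isClosed_eq hxc hyc, isOpen_iff_mem_nhds.2 fun t ht => ?_⟩
    obtain ⟨K, s, hs, hK⟩ := (hv t).exists_lipschitzOnWith
    have hys : ∀ᶠ u in 𝓝 t, y u ∈ s := hyc.continuousAt.eventually (by rwa [← mem_ofPred.1 ht])
    exact ODE_solution_unique_of_eventually (v := fun _ => v) (s := fun _ => s)
      (Eventually.of_forall fun _ => hK)
      ((hxc.continuousAt.eventually hs).mono fun u hu => ⟨hx u, hu⟩)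
      (hys.mono fun u hu => ⟨hy u, hu⟩) ht
  have huniv := hclopen.eq_univ ⟨t₀, h⟩
  funext t
  exact huniv.ge (mem_univ t)

/-- A nonconstant continuous periodic function on the line has a least positive period. -/
lemma exists_minimal_period {E : Type*} [TopologicalSpace E] [T2Space E] {x : ℝ → E}
    (hx : Continuous x) (hne : ∃ t, x t ≠ x 0) {p : ℝ} (hp : 0 < p)
    (hper : Function.Periodic x p) :
    ∃ T, 0 < T ∧ T ≤ p ∧ Function.Periodic x T ∧ ∀ τ, 0 < τ → τ < T → ¬ Function.Periodic x τ := by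
  set P : AddSubgroup ℝ :=
    { carrier := {τ | Function.Periodic x τ}
      zero_mem' := fun t => by simp
      add_mem' := fun h1 h2 => h1.add_period h2
      neg_mem' := fun h => h.neg }
  have hmem : ∀ τ, τ ∈ P ↔ Function.Periodic x τ := fun τ => Iff.rfl
  -- A dense group of periods would force the function to be constant; a cyclic one has a least
  -- positive element.
  rcases P.dense_or_cyclic with hd | ⟨a, ha⟩
  · obtain ⟨t, ht⟩ := hne
    have h1 : ∀ τ ∈ (P : Set ℝ), x τ = x 0 := fun τ hτ => by simpa using (hmem τ).1 hτ 0
    exact absurd (congrFun (hx.ext_on hd continuous_const h1) t) ht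
  · have hmem' : ∀ τ, Function.Periodic x τ ↔ ∃ k : ℤ, k • a = τ := fun τ => by
      rw [← hmem, ha, AddSubgroup.mem_closure_singleton]
    have hlow : ∀ τ, 0 < τ → Function.Periodic x τ → |a| ≤ τ := fun τ hτ h => by
      obtain ⟨k, hk⟩ := (hmem' τ).1 h
      have hk0 : k ≠ 0 := by rintro rfl; simp at hk; exact hτ.ne hk
      rw [← abs_of_pos hτ, ← hk, zsmul_eq_mul, abs_mul]
      refine le_mul_of_one_le_left (abs_nonneg a) ?_
      exact_mod_cast Int.one_le_abs hk0
    have ha0 : a ≠ 0 := by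
      rintro rfl
      obtain ⟨k, hk⟩ := (hmem' p).1 hper
      simp at hk
      exact hp.ne hk
    refine ⟨|a|, abs_pos.2 ha0, hlow p hp hper, ?_, fun τ hτ hτa h => ?_⟩
    · have h1 : Function.Periodic x a := (hmem' a).2 ⟨1, one_zsmul a⟩
      rcases abs_choice a with h | h <;> rw [h]
      · exact h1
      · exact h1.neg
    · exact absurd (hlow τ hτ h) (not_le.2 hτa)

namespace IsConvexDefining

variable {F : Phase n → ℝ} (hF : IsConvexDefining F)

include hF

/-! ### The periodic orbit of a minimizer -/

/-- With H = g²/2, the curve ψ = mJz + c satisfies ψ' = mJ∇H(ψ), so g is constant along it. As ∇H is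
positively homogeneous of degree one, division by that constant gives an orbit on the boundary with
the same period. -/
lemma exists_periodic_orbit {z : ℝ → Phase n} (hz : z ∈ loopSpace n)
    (hmin : ∀ y ∈ loopSpace n,
      supportEnergy (body F) (deriv z) ≤ supportEnergy (body F) (deriv y)) {m : ℝ}
    (hm : 2 * m = supportEnergy (body F) (deriv z)) :
    ∃ x : ℝ → Phase n, Function.Periodic x (2 * Real.pi) ∧ (∀ t, F (x t) = 1) ∧
      ∀ t, HasDerivAt x (m • J (normal F (x t))) t := by
  have hzl := hz.1
  have hm0 : 0 < m := by
    have := supportEnergy_pos hF.isCompact_body hF.zero_mem_interior hzl hz.2.2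
    linarith
  obtain ⟨c, hc, hint⟩ := hF.exists_deriv_eq_hamGrad hz hmin hm
  set ψ : ℝ → Phase n := fun t => m • J (z t) + c with hψ
  have hzc := hzl.continuous
  have hψc : Continuous ψ := by fun_prop
  have hψp : Function.Periodic ψ (2 * Real.pi) := fun t => by simp only [hψ, hzl.periodic t]
  have hV : Continuous fun t => hamGrad F (ψ t) := hF.continuous_hamGrad.comp hψc
  have hVp : Function.Periodic (fun t => hamGrad F (ψ t)) (2 * Real.pi) := fun t => by
    simp only [hψp t]
  have hV0 : ∫ t in (0 : ℝ)..(2 * Real.pi), hamGrad F (ψ t) = 0 := by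
    rw [integral_circ, ← integral_congr_ae hc, hzl.integral_deriv_circ]
  -- The equation holds almost everywhere with a continuous right side; integrating it makes it hold
  -- everywhere.
  have hzeq : z = fun t => z 0 + ∫ s in (0 : ℝ)..t, hamGrad F (ψ s) := by
    refine periodic_eq_of_eqOn_Icc hzl.periodic (fun t => ?_) fun t ht => ?_
    · rw [← intervalIntegral.integral_add_adjacent_intervals (hV.intervalIntegrable 0 t)
        (hV.intervalIntegrable t (t + 2 * Real.pi)), hVp.intervalIntegral_add_eq t 0, zero_add,
        hV0, add_zero]
    · rw [eq_comm, ← eq_sub_iff_add_eq', ← hzl.integral_deriv ht]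
      refine intervalIntegral.integral_congr_ae ?_
      rw [ae_restrict_iff' measurableSet_Ioc] at hc
      filter_upwards [hc] with s hs hmem
      rw [uIoc_of_le ht.1] at hmem
      exact (hs (Ioc_subset_Ioc_right ht.2 hmem)).symm
  have hzd : ∀ t, HasDerivAt z (hamGrad F (ψ t)) t := fun t => by
    rw [hzeq]
    exact (hV.integral_hasStrictDerivAt 0 t).hasDerivAt.const_add _
  have hψd : ∀ t, HasDerivAt ψ (m • J (hamGrad F (ψ t))) t := fun t =>
    ((hasDerivAt_J (hzd t)).const_smul m).add_const c
  have hconst : ∀ t, gauge (body F) (ψ t) ^ 2 = gauge (body F) (ψ 0) ^ 2 := fun t => by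
    have h1 : ∀ t, HasDerivAt (fun s => gauge (body F) (ψ s) ^ 2 / 2) 0 t := fun t => by
      have h := hF.hasDerivAt_ham (hψd t)
      rwa [real_inner_smul_right, real_inner_comm, inner_J_self, mul_zero] at h
    have h2 := is_const_of_deriv_eq_zero (fun t => (h1 t).differentiableAt)
      (fun t => (h1 t).deriv) t 0
    linarith
  set r := gauge (body F) (ψ 0) with hr
  have hr0 : 0 < r := by
    refine (gauge_nonneg _).lt_of_ne' fun h => ?_
    have h1 : ∫ t, gauge (body F) (ψ t) ^ 2 ∂circ = 2 * m := hint
    have h2 : r = 0 := h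
    simp [hconst, h2] at h1
    linarith
  have hrt : ∀ t, gauge (body F) (ψ t) = r := fun t =>
    (pow_left_inj₀ (gauge_nonneg _) hr0.le two_ne_zero).1 (hconst t)
  refine ⟨fun t => r⁻¹ • ψ t, fun t => by simp only [hψp t], fun t => ?_, fun t => ?_⟩
  · rw [← hF.gauge_eq_one_iff, gauge_smul_of_nonneg (inv_nonneg.2 hr0.le), smul_eq_mul, hrt,
      inv_mul_cancel₀ hr0.ne']
  · refine ((hψd t).const_smul r⁻¹).congr_deriv ?_
    rw [hamGrad, hrt, J_smul, smul_comm r⁻¹ m, inv_smul_smul₀ hr0.ne']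

lemma normal_ne_zero {x : Phase n} (hx : F x = 1) : normal F x ≠ 0 := fun h => by
  have := hF.inner_normal_self hx
  simp [h] at this

/-- Bootstrapping: a C^k orbit has a C^k derivative, since the normal field is smooth near the level
set. -/
lemma contDiff_of_orbit {x : ℝ → Phase n} {m : ℝ} (hx : ∀ t, F (x t) = 1)
    (hd : ∀ t, HasDerivAt x (m • J (normal F (x t))) t) : ContDiff ℝ ∞ x := by
  refine contDiff_infty.2 fun k => ?_
  induction k with
  | zero =>
    exact contDiff_zero.2 (continuous_iff_continuousAt.2 fun t => (hd t).continuousAt)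
  | succ k ih =>
    rw [Nat.cast_succ, contDiff_succ_iff_deriv]
    refine ⟨fun t => (hd t).differentiableAt, by simp, ?_⟩
    rw [show deriv x = fun t => m • J (normal F (x t)) from funext fun t => (hd t).deriv]
    have h1 : ContDiff ℝ k fun t => normal F (x t) := contDiff_iff_contDiffAt.2 fun t =>
      have h2 : ContDiffAt ℝ k (normal F) (x t) :=
        (hF.contDiffAt_normal (hx t)).of_le (by exact_mod_cast le_top)
      h2.comp t ih.contDiffAt
    exact ((Jl n).contDiff.comp h1).const_smul m

/-- ω(Jν, η) = -⟨ν, η⟩ for the normal ν. The differential of F kills tangent vectors η because F is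
constant on the frontier: a singleton has no nonzero tangent direction. -/
lemma mem_characteristicLine {x : ℝ → Phase n} {m t : ℝ} (hx : ∀ t, F (x t) = 1)
    (hd : HasDerivAt x (m • J (normal F (x t))) t) :
    m • J (normal F (x t)) ∈ characteristicLine (body F) (x t) := by
  constructor
  · have h1 := hd.hasFDerivAt.hasFDerivWithinAt (s := univ) |>.mapsTo_tangent_cone
      (show (1 : ℝ) ∈ tangentConeAt ℝ univ t by simp)
    have h2 : x '' univ ⊆ frontier (body F) := by
      rintro _ ⟨s, -, rfl⟩
      exact hF.mem_frontier_iff.2 (hx s)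
    simpa using tangentConeAt_mono h2 h1
  · intro η hη
    have h1 := ((hF.differentiable (x t)).hasFDerivAt.hasFDerivWithinAt
      (s := frontier (body F))).mapsTo_tangent_cone hη
    have h2 : F '' frontier (body F) ⊆ {F (x t)} := by
      rintro _ ⟨y, hy, rfl⟩
      rw [mem_singleton_iff, hx t, hF.mem_frontier_iff.1 hy]
    have h3 : fderiv ℝ F (x t) η = 0 := by
      by_contra h
      have := (AccPt.of_mem_tangentConeAt_ne_zero h1 h).mono (principal_mono.2 h2)
      obtain ⟨y, ⟨-, hy⟩, hne⟩ := accPt_iff_nhds.1 this univ univ_mem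
      exact hne hy
    rw [← inner_J_eq_omega, J_smul, J_J, real_inner_smul_left, inner_neg_left, normal,
      real_inner_smul_left, inner_gradient _ η, h3]
    simp

/-- The primitive period of a periodic orbit is a closed characteristic. -/
lemma exists_isClosedCharacteristic_of_orbit {x : ℝ → Phase n} {m : ℝ} (hm : 0 < m)
    (hp : Function.Periodic x (2 * Real.pi)) (hx : ∀ t, F (x t) = 1)
    (hd : ∀ t, HasDerivAt x (m • J (normal F (x t))) t) :
    ∃ γ, IsClosedCharacteristic (body F) γ ∧ |action γ| ≤ Real.pi * m := by
  have hxs := hF.contDiff_of_orbit hx hd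
  have hv0 : ∀ t, m • J (normal F (x t)) ≠ 0 := fun t h => by
    rcases smul_eq_zero.1 h with h | h
    · exact hm.ne' h
    · refine hF.normal_ne_zero (hx t) (norm_eq_zero.1 ?_)
      rw [← norm_J, h, norm_zero]
  have hne : ∃ t, x t ≠ x 0 := by
    by_contra! h
    refine hv0 0 ((hd 0).unique ?_)
    rw [funext h]
    exact hasDerivAt_const 0 (x 0)
  obtain ⟨T, hT0, hT, hTp, hTmin⟩ := exists_minimal_period hxs.continuous hne Real.two_pi_pos hp
  set σ := T / (2 * Real.pi) with hσ
  have hσ0 : 0 < σ := div_pos hT0 Real.two_pi_pos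
  have hσ1 : σ ≤ 1 := (div_le_one Real.two_pi_pos).2 hT
  have hσT : σ * (2 * Real.pi) = T := div_mul_cancel₀ T Real.two_pi_pos.ne'
  have hγd : ∀ t, HasDerivAt (fun t => x (σ * t)) ((σ * m) • J (normal F (x (σ * t)))) t := by
    intro t
    have h1 : HasDerivAt (fun t : ℝ => σ * t) σ t := by simpa using (hasDerivAt_id t).const_mul σ
    refine ((hd (σ * t)).scomp t h1).congr_deriv ?_
    rw [smul_smul]
  -- By uniqueness for the autonomous equation, a self-intersection would be a period shorter than
  -- T.
  have hinj : ∀ s s', s < s' → s' < s + T → x s ≠ x s' := by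
    intro s s' h1 h2 h
    refine hTmin (s' - s) (by linarith) (by linarith) fun t => ?_
    have hshift : ∀ a t, HasDerivAt (fun t => x (t + a)) (m • J (normal F (x (t + a)))) t :=
      fun a t => (hd (t + a)).comp_add_const t a
    have h3 := eq_of_autonomous_ode (v := fun y => m • J (normal F y))
      (x := fun t => x (t + s')) (y := fun t => x (t + s)) (t₀ := 0) (fun t => ?_)
      (hshift s') (hshift s) (by simpa using h.symm)
    · have h4 := congrFun h3 (t - s)
      simp only [sub_add_cancel] at h4
      rw [← h4]
      congr 1
      ring
    · have h4 : ContDiffAt ℝ 1 (normal F) (x (t + s')) :=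
        (hF.contDiffAt_normal (hx _)).of_le (by simp)
      exact ((Jl n).contDiff.contDiffAt.comp _ h4).const_smul m
  refine ⟨fun t => x (σ * t), ⟨hxs.comp (contDiff_const.mul contDiff_id), fun t => ?_, ?_,
    fun t => ?_, fun t => hF.mem_frontier_iff.2 (hx _), fun t => ?_⟩, ?_⟩
  · simp only [mul_add, hσT, hTp (σ * t)]
  · intro s hs s' hs' h
    have hlt : ∀ s ∈ Ico 0 (2 * Real.pi), ∀ s' ∈ Ico 0 (2 * Real.pi), s < s' →
        x (σ * s) ≠ x (σ * s') := by
      intro s hs s' hs' h1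
      refine hinj _ _ (mul_lt_mul_of_pos_left h1 hσ0) ?_
      have h2 := mul_lt_mul_of_pos_left hs'.2 hσ0
      have h3 := mul_nonneg hσ0.le hs.1
      linarith
    rcases lt_trichotomy s s' with h1 | h1 | h1
    · exact absurd h (hlt s hs s' hs' h1)
    · exact h1
    · exact absurd h.symm (hlt s' hs' s hs h1)
  · rw [(hγd t).deriv, mul_smul]
    exact smul_ne_zero hσ0.ne' (hv0 _)
  · rw [(hγd t).deriv]
    exact hF.mem_characteristicLine (x := fun t => x (σ * t)) (fun t => hx _) (hγd t)
  · have h1 : ∀ t, inner ℝ (J (x (σ * t))) (deriv (fun t => x (σ * t)) t) = σ * m := fun t => by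
      rw [(hγd t).deriv, real_inner_smul_right, inner_J_J, real_inner_comm,
        hF.inner_normal_self (hx _), mul_one]
    simp only [action, h1]
    rw [intervalIntegral.integral_const, sub_zero, smul_eq_mul, abs_of_nonneg (by positivity)]
    have := mul_le_mul_of_nonneg_right hσ1 hm.le
    nlinarith [Real.pi_pos]

/-- The capacity of `{F ≤ 1}` is at most the value of the dual functional at any loop. -/
theorem capacityEHZ_le (hn : 1 ≤ n) {y : ℝ → Phase n} (hy : y ∈ loopSpace n) :
    capacityEHZ (body F) ≤
      ENNReal.ofReal (Real.pi / 2 * supportEnergy (body F) (deriv y)) := by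
  obtain ⟨z, hz, hmin⟩ := exists_minimizer hn hF.isCompact_body hF.zero_mem_interior
  have hpos := supportEnergy_pos hF.isCompact_body hF.zero_mem_interior hz.1 hz.2.2
  have hm : 2 * (supportEnergy (body F) (deriv z) / 2) = supportEnergy (body F) (deriv z) := by ring
  obtain ⟨x, hp, hx, hd⟩ := hF.exists_periodic_orbit hz hmin hm
  obtain ⟨γ, hγ, hle⟩ := hF.exists_isClosedCharacteristic_of_orbit (half_pos hpos) hp hx hd
  refine (iInf₂_le |action γ| ⟨γ, hγ, rfl⟩).trans (ENNReal.ofReal_le_ofReal (hle.trans ?_))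
  have := mul_le_mul_of_nonneg_left (hmin y hy) Real.pi_pos.le
  linarith

end IsConvexDefining

/-! ### Tangent spaces of smooth boundaries -/

lemma eventually_pos_of_hasDerivAt {f : ℝ → ℝ} {d : ℝ} (hf : HasDerivAt f d 0) (h0 : f 0 = 0)
    (hd : 0 < d) : ∀ᶠ s in 𝓝[>] (0 : ℝ), 0 < f s := by
  have h := hf.hasDerivWithinAt (s := Ioi 0)
  rw [hasDerivWithinAt_iff_tendsto_slope' (by simp)] at h
  filter_upwards [h.eventually (lt_mem_nhds hd), self_mem_nhdsWithin] with s hs hs0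
  rw [slope_def_field, h0, sub_zero, sub_zero] at hs
  exact (div_pos_iff_of_pos_right (mem_Ioi.1 hs0)).1 hs

/-- Otherwise the interior and the complement of the closure would disconnect t. -/
lemma _root_.IsPreconnected.exists_mem_frontier {X : Type*} [TopologicalSpace X] {t S : Set X}
    (ht : IsPreconnected t) (h1 : (t ∩ S).Nonempty) (h2 : (t ∩ Sᶜ).Nonempty) :
    (t ∩ frontier S).Nonempty := by
  by_contra! h
  have hfr : ∀ y ∈ t, y ∈ closure S → y ∈ interior S := fun y hy hc => by
    by_contra hi
    exact (h.subset ⟨hy, hc, hi⟩ : y ∈ (∅ : Set X))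
  obtain ⟨a, hat, haS⟩ := h1
  obtain ⟨b, hbt, hbS⟩ := h2
  obtain ⟨y, -, hy1, hy2⟩ := ht (interior S) (closure S)ᶜ isOpen_interior isClosed_closure.isOpen_compl
    (fun y hy => (em (y ∈ closure S)).imp (hfr y hy) id)
    ⟨a, hat, hfr a hat (subset_closure haS)⟩
    ⟨b, hbt, fun hc => hbS (interior_subset (hfr b hbt hc))⟩
  exact hy2 (subset_closure (interior_subset hy1))

section Boundary

variable {S : Set (Phase n)} {U : Set (Phase n)} {F : Phase n → ℝ} {x : Phase n}

lemma eq_zero_of_mem_frontier (hU : IsOpen U) (hxU : x ∈ U) (hFc : ContinuousAt F x)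
    (hSU : S ∩ U = {y ∈ U | F y ≤ 0}) (hS : IsClosed S) (hx : x ∈ frontier S) : F x = 0 := by
  have hxS : x ∈ S := hS.frontier_subset hx
  have h1 : x ∈ {y ∈ U | F y ≤ 0} := hSU ▸ ⟨hxS, hxU⟩
  refine le_antisymm h1.2 (not_lt.1 fun h => hx.2 ?_)
  rw [mem_interior_iff_mem_nhds]
  filter_upwards [hFc.eventually (gt_mem_nhds h), hU.mem_nhds hxU] with y hy hyU
  exact (hSU.ge ⟨hyU, hy.le⟩ : y ∈ S ∩ U).1

variable {N : Phase n}

lemma eventually_mem_and_line (hU : IsOpen U) (hxU : x ∈ U) (v : Phase n) :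
    ∀ᶠ s in 𝓝[>] (0 : ℝ), x + s • v ∈ U := by
  have h : Continuous fun s : ℝ => x + s • v := by fun_prop
  exact (h.continuousAt.eventually (hU.mem_nhds (by simpa using hxU))).filter_mono
    nhdsWithin_le_nhds

/-- For small s > 0 the points x + s(η ± δN) lie on opposite sides of the boundary, so the segment
joining them meets it at some x + s(η + θN) with |θ| ≤ δ. Let δ → 0. -/
lemma mem_tangentConeAt_frontier (hU : IsOpen U) (hxU : x ∈ U) (hF : HasGradientAt F N x)
    (hN : N ≠ 0) (hFx : F x = 0) (hSU : S ∩ U = {y ∈ U | F y ≤ 0}) {η : Phase n}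
    (hη : inner ℝ N η = 0) : η ∈ tangentConeAt ℝ (frontier S) x := by
  have hline : ∀ v, HasDerivAt (fun s : ℝ => F (x + s • v)) (inner ℝ N v) 0 := fun v => by
    simpa [HasLineDerivAt] using hF.hasFDerivAt.hasLineDerivAt v
  have hNN : 0 < inner ℝ N N := real_inner_self_pos.2 hN
  have key : ∀ δ : ℝ, 0 < δ → ∃ s θ : ℝ, 0 < s ∧ s < δ ∧ |θ| ≤ δ ∧
      x + s • (η + θ • N) ∈ frontier S := by
    intro δ hδ
    have h1 := eventually_pos_of_hasDerivAt (hline (η + δ • N)) (by simpa using hFx)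
      (by rw [inner_add_right, inner_smul_right, hη, zero_add]; positivity)
    have h2 := eventually_pos_of_hasDerivAt (hline (η + (-δ) • N)).neg (by simpa using hFx)
      (by rw [inner_add_right, inner_smul_right, hη, zero_add, neg_mul, neg_neg]; positivity)
    obtain ⟨s, ⟨⟨⟨h1, h2⟩, h3⟩, h4⟩, hs0, hsδ⟩ := ((((h1.and h2).and
      (eventually_mem_and_line hU hxU (η + δ • N))).and
      (eventually_mem_and_line hU hxU (η + (-δ) • N))).and (Ioo_mem_nhdsGT hδ)).exists
    have hcon : IsPreconnected ((fun θ : ℝ => x + s • (η + θ • N)) '' Icc (-δ) δ) :=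
      isPreconnected_Icc.image _ (by fun_prop)
    obtain ⟨_, ⟨θ, hθ, rfl⟩, hfr⟩ := hcon.exists_mem_frontier (S := S)
      ⟨x + s • (η + (-δ) • N), ⟨-δ, ⟨le_rfl, by linarith⟩, rfl⟩,
        (hSU.ge ⟨h4, by simpa using h2.le⟩ : x + s • (η + (-δ) • N) ∈ S ∩ U).1⟩
      ⟨x + s • (η + δ • N), ⟨δ, ⟨by linarith, le_rfl⟩, rfl⟩, fun hmem =>
        absurd (hSU.le ⟨hmem, h3⟩ : x + s • (η + δ • N) ∈ {y ∈ U | F y ≤ 0}).2 (not_le.2 h1)⟩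
    exact ⟨s, θ, hs0, hsδ, abs_le.2 hθ, hfr⟩
  choose! s θ hs0 hsδ hθ hfr using key
  set δ : ℕ → ℝ := fun k => 1 / ((k : ℝ) + 1) with hδ
  have hδ0 : ∀ k, 0 < δ k := fun k => by positivity
  have hδl : Tendsto δ atTop (𝓝 0) := tendsto_one_div_add_atTop_nhds_zero_nat
  have hsl : Tendsto (fun k => s (δ k)) atTop (𝓝 0) :=
    squeeze_zero (fun k => (hs0 _ (hδ0 k)).le) (fun k => (hsδ _ (hδ0 k)).le) hδl
  have hθl : Tendsto (fun k => θ (δ k)) atTop (𝓝 0) :=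
    squeeze_zero_norm (fun k => hθ _ (hδ0 k)) hδl
  have hlim : Tendsto (fun k => η + θ (δ k) • N) atTop (𝓝 η) := by
    simpa using (hθl.smul_const N).const_add η
  refine mem_tangentConeAt_of_seq atTop (fun k => (s (δ k))⁻¹)
    (fun k => s (δ k) • (η + θ (δ k) • N)) (by simpa using hsl.smul hlim)
    (Eventually.of_forall fun k => hfr _ (hδ0 k)) (hlim.congr fun k => ?_)
  rw [inv_smul_smul₀ (hs0 _ (hδ0 k)).ne']

/-- If y lay strictly on the side N points to, the segment from x to y would enter {F > 0} at once,
against convexity of S. -/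
lemma inner_le_of_hasGradientAt (hU : IsOpen U) (hxU : x ∈ U) (hF : HasGradientAt F N x)
    (hFx : F x = 0) (hSU : S ∩ U = {y ∈ U | F y ≤ 0}) (hS : Convex ℝ S) (hx : x ∈ S)
    {y : Phase n} (hy : y ∈ S) : inner ℝ N y ≤ inner ℝ N x := by
  by_contra! h
  have hline : HasDerivAt (fun s : ℝ => F (x + s • (y - x))) (inner ℝ N (y - x)) 0 := by
    simpa [HasLineDerivAt] using hF.hasFDerivAt.hasLineDerivAt (y - x)
  have h1 := eventually_pos_of_hasDerivAt hline (by simpa using hFx)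
    (by rw [inner_sub_right]; linarith)
  obtain ⟨s, ⟨h1, h2⟩, hs⟩ := ((h1.and (eventually_mem_and_line hU hxU (y - x))).and
    (Ioo_mem_nhdsGT zero_lt_one)).exists
  have h3 : x + s • (y - x) ∈ S := hS.add_smul_sub_mem hx hy ⟨hs.1.le, hs.2.le⟩
  exact absurd (hSU.le ⟨h3, h2⟩ : x + s • (y - x) ∈ {y ∈ U | F y ≤ 0}).2 (not_le.2 h1)

/-- A characteristic vector `ξ` satisfies `J ξ = c N` with `N` an outer normal. -/
lemma exists_normal_of_mem_characteristicLine (hS : IsConvexBody S) (hsm : HasSmoothBoundary S)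
    (h0 : (0 : Phase n) ∈ interior S) (hx : x ∈ frontier S) {ξ : Phase n} (hξ0 : ξ ≠ 0)
    (hξ : ξ ∈ characteristicLine S x) :
    ∃ (N : Phase n) (c : ℝ), c ≠ 0 ∧ J ξ = c • N ∧ 0 < inner ℝ N x ∧
      ∀ y ∈ S, inner ℝ N y ≤ inner ℝ N x := by
  obtain ⟨U, F, hU, hxU, hFs, hF0, hSU⟩ := hsm x hx
  have hdiff : DifferentiableAt ℝ F x :=
    (hFs.contDiffAt (hU.mem_nhds hxU)).differentiableAt (by simp)
  set N := gradient F x with hNdef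
  have hF : HasGradientAt F N x := hdiff.hasGradientAt
  have hN : N ≠ 0 := fun h => hF0 (by
    rw [← toDual_gradient, ← hNdef, h, map_zero])
  have hFx := eq_zero_of_mem_frontier hU hxU hdiff.continuousAt hSU hS.isCompact.isClosed hx
  have hxS := hS.isCompact.isClosed.frontier_subset hx
  have hle : ∀ y ∈ S, inner ℝ N y ≤ inner ℝ N x := fun y hy =>
    inner_le_of_hasGradientAt hU hxU hF hFx hSU hS.convex hxS hy
  have hNN : 0 < inner ℝ N N := real_inner_self_pos.2 hN
  set c := inner ℝ (J ξ) N / inner ℝ N N with hc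
  have hperp : inner ℝ N (J ξ - c • N) = 0 := by
    rw [inner_sub_right, inner_smul_right, hc, div_mul_cancel₀ _ hNN.ne', real_inner_comm, sub_self]
  -- The part of Jξ orthogonal to N is tangent, so ω(ξ, ·) = ⟨Jξ, ·⟩ annihilates it.
  have hJ : inner ℝ (J ξ) (J ξ - c • N) = 0 := by
    rw [inner_J_eq_omega]
    exact hξ.2 _ (mem_tangentConeAt_frontier hU hxU hF hN hFx hSU hperp)
  have hJN : J ξ = c • N := by
    rw [← sub_eq_zero, ← inner_self_eq_zero (𝕜 := ℝ)]
    rw [inner_sub_left, hJ, real_inner_smul_left, hperp, mul_zero, sub_zero]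
  refine ⟨N, c, fun h => hξ0 ?_, hJN, ?_, hle⟩
  · rw [h, zero_smul] at hJN
    rw [← norm_eq_zero, ← norm_J, hJN, norm_zero]
  · obtain ⟨r, hr, -, hrS⟩ := exists_norm_le_supportFn hS.isCompact h0
    have h1 : supportFn S N ≤ inner ℝ N x := supportFn_le ⟨x, hxS⟩ fun y hy => by
      rw [real_inner_comm]; exact hle y hy
    have := mul_pos hr (norm_pos_iff.2 hN)
    linarith [hrS N]

end Boundary

/-! ### Loops from closed characteristics -/

/-- Reparametrization of a positively oriented curve so that the support function of the rotated
velocity becomes constant. -/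
lemma exists_reparametrization {S : Set (Phase n)} {γ : ℝ → Phase n} (hγ : ContDiff ℝ 1 γ)
    (hp : Function.Periodic γ (2 * Real.pi)) (hpos : ∀ t, 0 < inner ℝ (J (γ t)) (deriv γ t))
    (hsupp : ∀ t, supportFn S (-J (deriv γ t)) ≤ inner ℝ (J (γ t)) (deriv γ t)) :
    0 < action γ ∧ ∃ z, IsW12Loop z ∧ action z = action γ ∧
      ∀ t, supportFn S (deriv z t) ≤ action γ / Real.pi := by
  set v : ℝ → ℝ := fun t => inner ℝ (J (γ t)) (deriv γ t) with hv
  have hγc := hγ.continuous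
  have hγ'c := hγ.continuous_deriv le_rfl
  have hvc : Continuous v := by fun_prop
  have hγ'p : Function.Periodic (deriv γ) (2 * Real.pi) := fun t => by
    rw [← deriv_comp_add_const, show (fun s => γ (s + 2 * Real.pi)) = γ from funext hp]
  have hvp : Function.Periodic v (2 * Real.pi) := fun t => by simp only [hv, hp t, hγ'p t]
  have hvi : ∀ a b, IntervalIntegrable v volume a b := fun a b => hvc.intervalIntegrable a b
  have hA : 0 < action γ := mul_pos (by norm_num)
    (intervalIntegral.intervalIntegral_pos_of_pos (hvi _ _) hpos Real.two_pi_pos)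
  set κ := action γ / Real.pi with hκ
  have hκ0 : 0 < κ := div_pos hA Real.pi_pos
  have hκv : ∫ t in (0 : ℝ)..(2 * Real.pi), v t = κ * (2 * Real.pi) := by
    rw [hκ, action]
    field_simp
    rfl
  -- The normalized action is the new parameter; κ is the mean of v, so s advances by exactly 2π per
  -- period.
  set s : ℝ → ℝ := fun t => κ⁻¹ * ∫ u in (0 : ℝ)..t, v u with hs
  have hsd : ∀ t, HasDerivAt s (κ⁻¹ * v t) t := fun t =>
    (hvc.integral_hasStrictDerivAt 0 t).hasDerivAt.const_mul κ⁻¹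
  have hsc : Continuous s := continuous_iff_continuousAt.2 fun t => (hsd t).continuousAt
  have hsmono : StrictMono s := strictMono_of_deriv_pos fun t => by
    rw [(hsd t).deriv]
    exact mul_pos (inv_pos.2 hκ0) (hpos t)
  have hsp : ∀ t, s (t + 2 * Real.pi) = s t + 2 * Real.pi := fun t => by
    simp only [hs]
    rw [← intervalIntegral.integral_add_adjacent_intervals (hvi 0 t) (hvi t _),
      hvp.intervalIntegral_add_eq t 0, zero_add, hκv, mul_add, inv_mul_cancel_left₀ hκ0.ne']
  have hsz : ∀ k : ℤ, s (k * (2 * Real.pi)) = k * (2 * Real.pi) := by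
    intro k
    induction k using Int.induction_on with
    | zero => simp [hs]
    | succ k ih =>
      push_cast at ih ⊢
      rw [add_mul, one_mul, hsp, ih]
    | pred k ih =>
      have h1 := hsp ((-(k : ℝ) - 1) * (2 * Real.pi))
      push_cast at ih ⊢
      rw [show (-(k : ℝ) - 1) * (2 * Real.pi) + 2 * Real.pi = -(k : ℝ) * (2 * Real.pi) by ring,
        ih] at h1
      linarith
  have hssurj : Function.Surjective s := fun y => by
    refine mem_range_of_exists_le_of_exists_ge hsc
      ⟨(⌊y / (2 * Real.pi)⌋ : ℤ) * (2 * Real.pi), ?_⟩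
      ⟨(⌈y / (2 * Real.pi)⌉ : ℤ) * (2 * Real.pi), ?_⟩
    · rw [hsz, ← le_div_iff₀ Real.two_pi_pos]
      exact Int.floor_le _
    · rw [hsz, ← div_le_iff₀ Real.two_pi_pos]
      exact Int.le_ceil _
  set e := hsmono.orderIsoOfSurjective s hssurj with he
  set τ : ℝ → ℝ := ⇑e.symm with hτ
  have hsτ : ∀ θ, s (τ θ) = θ := fun θ => e.apply_symm_apply θ
  have hτc : Continuous τ := e.symm.continuous
  have hτd : ∀ θ, HasDerivAt τ (κ / v (τ θ)) θ := fun θ => by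
    have h := HasDerivAt.of_local_left_inverse hτc.continuousAt (hsd (τ θ))
      (mul_pos (inv_pos.2 hκ0) (hpos _)).ne' (Eventually.of_forall hsτ)
    rwa [mul_inv, inv_inv, ← div_eq_mul_inv] at h
  have hτp : ∀ θ, τ (θ + 2 * Real.pi) = τ θ + 2 * Real.pi := fun θ =>
    hsmono.injective (by rw [hsτ, hsp, hsτ])
  -- J preserves the action, and -J turns a characteristic velocity into an outward normal
  -- direction.
  set z : ℝ → Phase n := fun θ => -J (γ (τ θ)) with hz
  have hzd : ∀ θ, HasDerivAt z ((κ / v (τ θ)) • -J (deriv γ (τ θ))) θ := fun θ => by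
    have h1 : HasDerivAt γ (deriv γ (τ θ)) (τ θ) :=
      (hγ.differentiable one_ne_zero _).hasDerivAt
    refine (hasDerivAt_J (h1.scomp θ (hτd θ))).neg.congr_deriv ?_
    rw [J_smul, smul_neg]
  have hzd' : deriv z = fun θ => (κ / v (τ θ)) • -J (deriv γ (τ θ)) :=
    funext fun θ => (hzd θ).deriv
  have hzC : ContDiff ℝ 1 z := by
    refine contDiff_one_iff_deriv.2 ⟨fun θ => (hzd θ).differentiableAt, ?_⟩
    rw [hzd']
    exact (continuous_const.div (hvc.comp hτc) fun θ => (hpos _).ne').smul (by fun_prop)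
  refine ⟨hA, z, .of_contDiff hzC fun θ => ?_, ?_, fun θ => ?_⟩
  · simp only [hz, hτp, hp (τ θ)]
  · have h1 : ∀ θ, inner ℝ (J (z θ)) (deriv z θ) = κ := fun θ => by
      rw [hzd', inner_smul_right, inner_neg_right]
      simp only [hz]
      rw [J_neg, inner_neg_left, neg_neg, inner_J_J]
      exact div_mul_cancel₀ κ (hpos _).ne'
    rw [action]
    simp only [h1]
    rw [intervalIntegral.integral_const, sub_zero, smul_eq_mul, hκ]
    field_simp
  · rw [hzd']
    simp only
    rw [supportFn_smul (div_pos hκ0 (hpos _)).le]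
    calc κ / v (τ θ) * supportFn S (-J (deriv γ (τ θ))) ≤ κ / v (τ θ) * v (τ θ) :=
          mul_le_mul_of_nonneg_left (hsupp _) (div_pos hκ0 (hpos _)).le
      _ = κ := div_mul_cancel₀ κ (hpos _).ne'

lemma action_comp_neg {γ : ℝ → Phase n} (hp : Function.Periodic γ (2 * Real.pi)) :
    action (fun t => γ (-t)) = -action γ := by
  have hd : ∀ t, deriv (fun t => γ (-t)) t = -deriv γ (-t) := fun t => deriv_comp_neg γ t
  have hγ'p : Function.Periodic (deriv γ) (2 * Real.pi) := fun t => by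
    rw [← deriv_comp_add_const, show (fun s => γ (s + 2 * Real.pi)) = γ from funext hp]
  have hvp : Function.Periodic (fun t => inner ℝ (J (γ t)) (deriv γ t)) (2 * Real.pi) := fun t => by
    simp only [hp t, hγ'p t]
  simp only [action, hd, inner_neg_right, intervalIntegral.integral_neg]
  have h := hvp.intervalIntegral_add_eq (-(2 * Real.pi)) 0
  rw [neg_add_cancel, zero_add] at h
  rw [intervalIntegral.integral_comp_neg (fun t => inner ℝ (J (γ t)) (deriv γ t)), neg_zero,
    mul_neg, h]

/-- A closed characteristic on the boundary of a smooth convex body `S` yields a loop with constant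
support function of the velocity and action equal to the absolute value of the action. -/
lemma exists_loop_of_isClosedCharacteristic {S : Set (Phase n)} (hS : IsConvexBody S)
    (hsm : HasSmoothBoundary S) (h0 : (0 : Phase n) ∈ interior S) {γ : ℝ → Phase n}
    (hγ : IsClosedCharacteristic S γ) :
    0 < |action γ| ∧ ∃ z, IsW12Loop z ∧ action z = |action γ| ∧
      ∀ t, supportFn S (deriv z t) ≤ |action γ| / Real.pi := by
  have hC1 : ContDiff ℝ 1 γ := hγ.contDiff.of_le (by simp)
  have hne : S.Nonempty := ⟨0, interior_subset h0⟩
  have key : ∀ t, ∃ (N : Phase n) (c : ℝ), c ≠ 0 ∧ J (deriv γ t) = c • N ∧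
      0 < inner ℝ N (γ t) ∧ ∀ y ∈ S, inner ℝ N y ≤ inner ℝ N (γ t) := fun t =>
    exists_normal_of_mem_characteristicLine hS hsm h0 (hγ.mem_frontier t) (hγ.deriv_ne_zero t)
      (hγ.tangent t)
  choose N c hc0 hcN hNpos hNle using key
  -- Neither factor vanishes, so the continuous action density has constant sign; if it is negative,
  -- γ is reversed.
  have hv : ∀ t, inner ℝ (J (γ t)) (deriv γ t) = -c t * inner ℝ (N t) (γ t) := fun t => by
    rw [inner_J_left, hcN, real_inner_smul_right, real_inner_comm, neg_mul]
  have hsN : ∀ t, supportFn S (N t) ≤ inner ℝ (N t) (γ t) := fun t =>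
    supportFn_le hne fun y hy => by rw [real_inner_comm]; exact hNle t y hy
  have hvc : Continuous fun t => inner ℝ (J (γ t)) (deriv γ t) := by
    have := hC1.continuous
    have := hC1.continuous_deriv le_rfl
    fun_prop
  have hvne : ∀ t, inner ℝ (J (γ t)) (deriv γ t) ≠ 0 := fun t => by
    rw [hv]
    exact mul_ne_zero (neg_ne_zero.2 (hc0 t)) (hNpos t).ne'
  by_cases hsign : ∀ t, 0 < inner ℝ (J (γ t)) (deriv γ t)
  · have h := exists_reparametrization (S := S) hC1 hγ.periodic hsign fun t => by
      have h1 := hsign t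
      rw [hv] at h1 ⊢
      have hc : 0 < -c t := (mul_pos_iff_of_pos_right (hNpos t)).1 h1
      rw [hcN, ← neg_smul, supportFn_smul hc.le]
      exact mul_le_mul_of_nonneg_left (hsN t) hc.le
    rw [abs_of_pos h.1]
    exact h
  · have hneg : ∀ t, inner ℝ (J (γ t)) (deriv γ t) < 0 := by
      push Not at hsign
      obtain ⟨a, ha⟩ := hsign
      by_contra! h
      obtain ⟨b, hb⟩ := h
      obtain ⟨t, ht⟩ := mem_range_of_exists_le_of_exists_ge hvc ⟨a, ha⟩ ⟨b, hb⟩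
      exact hvne t ht
    have hd : ∀ t, deriv (fun t => γ (-t)) t = -deriv γ (-t) := fun t => deriv_comp_neg γ t
    have h := exists_reparametrization (S := S) (γ := fun t => γ (-t)) (hC1.comp contDiff_neg)
      (fun t => by
        have h1 := hγ.periodic (-(t + 2 * Real.pi))
        rw [show -(t + 2 * Real.pi) + 2 * Real.pi = -t by ring] at h1
        exact h1.symm)
      (fun t => by
        rw [hd, inner_neg_right]
        linarith [hneg (-t)]) fun t => by
      have h1 := hneg (-t)
      rw [hd, inner_neg_right, J_neg, neg_neg, hv]
      rw [hv] at h1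
      have hc : 0 < c (-t) := by
        by_contra! hle
        nlinarith [hNpos (-t)]
      rw [hcN, supportFn_smul hc.le, neg_mul, neg_neg]
      exact mul_le_mul_of_nonneg_left (hsN (-t)) hc.le
    rw [action_comp_neg hγ.periodic] at h
    rw [abs_of_neg (neg_pos.1 h.1)]
    exact h

/-- The action of a closed characteristic on a smooth convex body containing `S` bounds the dual
functional of `S` from above at some loop. -/
theorem exists_supportEnergy_le_of_isClosedCharacteristic {S S' : Set (Phase n)}
    (hS : IsCompact S) (h0 : (0 : Phase n) ∈ interior S) (hS' : IsConvexBody S')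
    (hsm : HasSmoothBoundary S') (hSS' : S ⊆ S') {γ : ℝ → Phase n}
    (hγ : IsClosedCharacteristic S' γ) :
    ∃ y ∈ loopSpace n, Real.pi / 2 * supportEnergy S (deriv y) ≤ |action γ| := by
  obtain ⟨hA, z, hz, hza, hzs⟩ := exists_loop_of_isClosedCharacteristic hS' hsm
    (interior_mono hSS' h0) hγ
  set A := |action γ|
  obtain ⟨y, hy, hd⟩ := hz.exists_mem_loopSpace (hza ▸ hA)
  refine ⟨y, hy, ?_⟩
  have h0' := interior_subset h0
  have h1 : supportEnergy S (deriv z) ≤ ∫ _, (A / Real.pi) ^ 2 ∂circ := by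
    refine integral_mono (integrable_supportFn_sq hS ⟨0, h0'⟩ hz.memLp_deriv) (integrable_const _)
      fun t => pow_le_pow_left₀ (supportFn_nonneg hS h0' _) ?_ 2
    exact (supportFn_mono hS'.isCompact ⟨0, h0'⟩ hSS' _).trans (hzs t)
  rw [integral_const, measureReal_restrict_apply_univ, Real.volume_real_Ioc,
    max_eq_left (by linarith [Real.two_pi_pos]), sub_zero, smul_eq_mul] at h1
  rw [funext hd, supportEnergy_smul (by positivity), inv_pow, Real.sq_sqrt (hza ▸ hA.le), hza]
  calc Real.pi / 2 * (A⁻¹ * supportEnergy S (deriv z))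
      ≤ Real.pi / 2 * (A⁻¹ * (2 * Real.pi * (A / Real.pi) ^ 2)) := by gcongr
    _ = A := by field_simp

/-! ### The extended capacity -/

section

variable {S : Set (Phase n)}

lemma le_extendedCapacityEHZ (hS : IsConvexBody S) (h0 : (0 : Phase n) ∈ interior S) {a : ℝ}
    (ha : ∀ y ∈ loopSpace n, a ≤ Real.pi / 2 * supportEnergy S (deriv y)) :
    ENNReal.ofReal a ≤ extendedCapacityEHZ S := by
  refine le_iInf₂ fun S' hS' => le_iInf₂ fun b hb => ?_
  obtain ⟨γ, hγ, rfl⟩ := hb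
  obtain ⟨y, hy, hle⟩ := exists_supportEnergy_le_of_isClosedCharacteristic hS.isCompact h0 hS'.1
    hS'.2.1 hS'.2.2 hγ
  exact ENNReal.ofReal_le_ofReal ((ha y hy).trans hle)

/-- A smooth body between S and (1+ε)S has support function at most (1+ε)h_S, which costs a factor
(1+ε)² that disappears as ε → 0. -/
lemma extendedCapacityEHZ_le (hn : 1 ≤ n) (hS : IsConvexBody S) (h0 : (0 : Phase n) ∈ interior S)
    {y : ℝ → Phase n} (hy : y ∈ loopSpace n) :
    extendedCapacityEHZ S ≤ ENNReal.ofReal (Real.pi / 2 * supportEnergy S (deriv y)) := by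
  have h0' := interior_subset h0
  set a := Real.pi / 2 * supportEnergy S (deriv y) with ha
  have hε : ∀ ε : ℝ, 0 < ε → extendedCapacityEHZ S ≤ ENNReal.ofReal ((1 + ε) ^ 2 * a) := by
    intro ε hε
    obtain ⟨F, hF, hSF, hFS⟩ := exists_isConvexDefining hS h0 hε
    have hε1 : 0 < 1 + ε := by positivity
    refine (iInf₂_le (body F) ⟨hF.isConvexBody, hF.hasSmoothBoundary, hSF⟩).trans
      ((hF.capacityEHZ_le hn hy).trans (ENNReal.ofReal_le_ofReal ?_))
    have h1 : ∀ u, supportFn (body F) u ≤ supportFn S ((1 + ε) • u) := fun u =>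
      supportFn_le ⟨0, hSF 0 h0'⟩ fun x hx => by
        have h2 := inner_le_supportFn hS.isCompact (hFS x hx) ((1 + ε) • u)
        rwa [real_inner_smul_left, real_inner_smul_right, inv_mul_cancel_left₀ hε1.ne'] at h2
    have h2 : supportEnergy (body F) (deriv y) ≤ (1 + ε) ^ 2 * supportEnergy S (deriv y) := by
      rw [← supportEnergy_smul hε1.le]
      exact supportEnergy_mono hF.isCompact_body (hSF 0 h0') hS.isCompact ⟨0, h0'⟩
        hy.1.memLp_deriv (hy.1.memLp_deriv.const_smul (1 + ε)) (ae_of_all _ fun t => h1 _)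
    rw [ha]
    nlinarith [Real.pi_pos]
  have hlim : Tendsto (fun ε : ℝ => ENNReal.ofReal ((1 + ε) ^ 2 * a)) (𝓝[>] 0)
      (𝓝 (ENNReal.ofReal a)) := by
    have hc : Continuous fun ε : ℝ => ENNReal.ofReal ((1 + ε) ^ 2 * a) :=
      ENNReal.continuous_ofReal.comp (by fun_prop)
    simpa using (hc.tendsto 0).mono_left (nhdsWithin_le_nhds (s := Ioi 0))
  exact ge_of_tendsto hlim (by filter_upwards [self_mem_nhdsWithin] with ε h using hε ε h)

end

end EHZ

end

theorem mainTheorem7 {n : ℕ} (hn : 1 ≤ n) (S : Set (EHZ.Phase n)) (hS : EHZ.IsConvexBody S)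
    (h0 : (0 : EHZ.Phase n) ∈ interior S) :
    IsLeast
      ((fun z : ℝ → EHZ.Phase n => ENNReal.ofReal
          (Real.pi / 2 * ∫ t in (0 : ℝ)..(2 * Real.pi), (EHZ.supportFn S (deriv z t)) ^ 2)) ''
        EHZ.loopSpace n)
      (EHZ.extendedCapacityEHZ S) := by
  have hE : ∀ z : ℝ → EHZ.Phase n,
      ∫ t in (0 : ℝ)..(2 * Real.pi), (EHZ.supportFn S (deriv z t)) ^ 2 =
        EHZ.supportEnergy S (deriv z) := fun z => EHZ.integral_circ _
  simp only [hE]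
  obtain ⟨z, hz, hmin⟩ := EHZ.exists_minimizer hn hS.isCompact h0
  refine ⟨⟨z, hz, le_antisymm ?_ (EHZ.extendedCapacityEHZ_le hn hS h0 hz)⟩, ?_⟩
  · exact EHZ.le_extendedCapacityEHZ hS h0 fun y hy =>
      mul_le_mul_of_nonneg_left (hmin y hy) (by positivity)
  · rintro _ ⟨y, hy, rfl⟩
    exact EHZ.extendedCapacityEHZ_le hn hS h0 hy
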